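/- Let $H\in(0,\tfrac34]$ and let $$s_H(k)=\tfrac12\big(|k+1|^{2H}+|k-1|^{2H}-2|k|^{2H}\big),\qquad k\in\mathbb Z .$$ Let $(X_{ij})_{i,j\ge 1}$ be a centered jointly Gaussian family with $\mathbb E[X_{ij}X_{i'j'}]=\mathbf 1_{\{i=i'\}}\,s_H(j-j')$. For $n,d\ge 1$ let $\mathcal X_{n,d}=(X_{ij})_{1\le i\le n,\,1\le j\le d}$ and $$\mathcal W_{n,d}=\sqrt d\,\Big(\tfrac1d\,\mathcal X_{n,d}\mathcal X_{n,d}^T-I_n\Big).$$ Let $\mathcal G_{n,d}$ be a centered Gaussian symmetric random $n\times n$ matrix whose $n^2$ entries have the same covariance matrix as those of $\mathcal W_{n,d}$. If $\|s_H\|^2:=\sum_{k\in\mathbb Z}s_H(k)^2<\infty$, let $\mathcal Z_n=(Z_{ij})$ be a symmetric random $n\times n$ matrix with $\{Z_{ij}\}_{i\le j}$ independent, $Z_{ii}\sim N(0,2\|s_H\|^2)$ and $Z_{ij}\sim N(0,\|s_H\|^2)$ for $i<j$. For random $n\times n$ matrices $A,B$ let $d_{\rm FM}(A,B)=\sup\{\mathbb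 E[g(A)]-\mathbb E[g(B)]\}$, the supremum being over all $g:M_n(\mathbb R)\to\mathbb R$ with $\|g\|_\infty+\|g\|_{\rm Lip}\le 1$, where $\|g\|_{\rm Lip}$ is the Lipschitz constant with respect to the Hilbert--Schmidt norm. For $\phi$ with values in $[0,\infty]$, families $A_{n,d}$ and $B_{n,d}$ are called $\phi$-close if $d_{\rm FM}(A_{n,d},B_{n,d})\to0$ when $n,d\to\infty$ and $\phi(n,d)\to0$. Then: (i) If $0<H<\frac12$, then $\|s_H\|<\infty$, $\mathcal W_{n,d}$ is $\phi$-close to $\mathcal G_{n,d}$ for $\phi(n,d)=n^3/d$, and $\mathcal G_{n,d}$ is $\psi$-close to $\mathcal Z_n$ for $\psi(n,d)=n/d$. (ii) If $H=\frac12$, then $\|s_H\|<\infty$, $\mathcal W_{n,d}$ is $\phi$-close to $\mathcal G_{n,d}$ for $\phi(n,d)=n^3/d$, and $\mathcal G_{n,d}$ and $\mathcal Z_n$ have the same law for all $n,d\ge1$. (iii) If $\frac12<H<\frac58$, then $\|s_H\|<\infty$, $\mathcal W_{n,d}$ is $\phi$-close to $\mathcal G_{n,d}$ for $\phi(n,d)=n^3/d$,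 and $\mathcal G_{n,d}$ is $\psi$-close to $\mathcal Z_n$ for $\psi(n,d)=n\,d^{4H-3}$. (iv) If $H=\frac58$, then $\|s_H\|<\infty$, $\mathcal W_{n,d}$ is $\phi$-close to $\mathcal G_{n,d}$ for $\phi(n,d)=n^3(\log d)^3/d$, and $\mathcal G_{n,d}$ is $\psi$-close to $\mathcal Z_n$ for $\psi(n,d)=n/\sqrt d$. (v) If $\frac58<H<\frac34$, then $\|s_H\|<\infty$, $\mathcal W_{n,d}$ is $\phi$-close to $\mathcal G_{n,d}$ for $\phi(n,d)=n^3d^{8H-6}$, and $\mathcal G_{n,d}$ is $\psi$-close to $\mathcal Z_n$ for $\psi(n,d)=n\,d^{4H-3}$. (vi) If $H=\frac34$, then $\mathcal W_{n,d}$ is $\phi$-close to $\mathcal G_{n,d}$ for $\phi(n,d)=n^3/\log d$, and $\sum_{k}s_H(k)^2=\infty$, so that $\mathcal Z_n$ is not defined. -/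

import Mathlib

open MeasureTheory ProbabilityTheory Filter Topology
open scoped ENNReal NNReal

noncomputable section

/-- The correlation function of fractional Gaussian noise of Hurst index `H`. -/
def fracCorr (H : ℝ) (k : ℤ) : ℝ :=
  (|(k : ℝ) + 1| ^ (2 * H) + |(k : ℝ) - 1| ^ (2 * H) - 2 * |(k : ℝ)| ^ (2 * H)) / 2

/-- `X` is a centered, jointly Gaussian array with
`E[X i j * X i' j'] = 1_{i = i'} * s (j - j')`. Rows and columns are numbered from `0`. -/
structure IsRowIndepGaussianArray {Ω : Type*} [MeasurableSpace Ω] (s : ℤ → ℝ)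
    (X : ℕ → ℕ → Ω → ℝ) (P : Measure Ω) : Prop where
  gaussian : IsGaussianProcess (fun (p : ℕ × ℕ) (ω : Ω) => X p.1 p.2 ω) P
  centered : ∀ i j, ∫ ω, X i j ω ∂P = 0
  corr : ∀ i j i' j',
    ∫ ω, X i j ω * X i' j' ω ∂P = if i = i' then s ((j : ℤ) - (j' : ℤ)) else 0

/-- The space of real `n × n` matrices with the Hilbert-Schmidt (Frobenius) norm, that is, the
Euclidean space of all families of `n * n` entries. -/
abbrev HSMatrix (n : ℕ) : Type := EuclideanSpace ℝ (Fin n × Fin n)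

/-- A matrix seen as an element of `HSMatrix n`. -/
def toHS {n : ℕ} (A : Matrix (Fin n) (Fin n) ℝ) : HSMatrix n :=
  WithLp.toLp 2 (fun p : Fin n × Fin n => A p.1 p.2)

section Ensembles

variable {Ω : Type*} [MeasurableSpace Ω]

/-- The `n × d` upper left corner of an infinite random array. -/
def dataMatrix (X : ℕ → ℕ → Ω → ℝ) (n d : ℕ) (ω : Ω) : Matrix (Fin n) (Fin d) ℝ :=
  Matrix.of fun i k => X i k ω

/-- The normalized Wishart matrix `√d (d⁻¹ 𝒳 𝒳ᵀ - I)`. -/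
def wishart (X : ℕ → ℕ → Ω → ℝ) (n d : ℕ) (ω : Ω) : Matrix (Fin n) (Fin n) ℝ :=
  √(d : ℝ) • ((1 / (d : ℝ)) • (dataMatrix X n d ω * (dataMatrix X n d ω).transpose) - 1)

/-- The law of the normalized Wishart matrix. -/
def wishartLaw (X : ℕ → ℕ → Ω → ℝ) (P : Measure Ω) (n d : ℕ) : Measure (HSMatrix n) :=
  P.map (fun ω => toHS (wishart X n d ω))

/-- The covariance matrix of the entries of the normalized Wishart matrix. -/
def wishartCov (X : ℕ → ℕ → Ω → ℝ) (P : Measure Ω) (n d : ℕ) :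
    Matrix (Fin n × Fin n) (Fin n × Fin n) ℝ :=
  Matrix.of fun p q => cov[fun ω => wishart X n d ω p.1 p.2, fun ω => wishart X n d ω q.1 q.2; P]

/-- The law of the matrix `𝒢`: the centered Gaussian law on matrices with the same covariance as
the normalized Wishart matrix. -/
def gaussianCounterpartLaw (X : ℕ → ℕ → Ω → ℝ) (P : Measure Ω) (n d : ℕ) :
    Measure (HSMatrix n) :=
  multivariateGaussian 0 (wishartCov X P n d)

end Ensembles

/-- `‖s‖²` in `ℓ²(ℤ)`; meaningful when `s` is square-summable. -/
def ellTwoSq (s : ℤ → ℝ) : ℝ≥0 := (∑' k : ℤ, s k ^ 2).toNNReal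

/-- The GOE-type law with parameter `v`: the law of a symmetric matrix whose entries on and above
the diagonal are independent, `N(0, 2v)` on the diagonal and `N(0, v)` above it. -/
def goeLaw (v : ℝ≥0) (n : ℕ) : Measure (HSMatrix n) :=
  (Measure.pi fun p : Fin n × Fin n => gaussianReal 0 (if p.1 = p.2 then 2 * v else v)).map
    (fun z => toHS (Matrix.of fun i j => z (min i j, max i j)))

/-- The Fortet-Mourier distance: the supremum of `∫ g dμ - ∫ g dν` over all `g` with
`‖g‖_∞ + ‖g‖_Lip ≤ 1`. (For probability measures the set is bounded and contains `0`.) -/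
def fortetMourierDist {E : Type*} [PseudoMetricSpace E] [MeasurableSpace E]
    (μ ν : Measure E) : ℝ :=
  sSup {r : ℝ | ∃ (g : E → ℝ) (M L : ℝ≥0), M + L ≤ 1 ∧ (∀ x, |g x| ≤ M) ∧ LipschitzWith L g ∧
    r = ∫ x, g x ∂μ - ∫ x, g x ∂ν}

/-- Two families of laws of random `n × n` matrices are `φ`-close if their Fortet-Mourier distance
tends to `0` as `n, d → ∞` and `φ n d → 0`. -/
def PhiClose (φ : ℕ → ℕ → ℝ≥0∞) (μ ν : (n d : ℕ) → Measure (HSMatrix n)) : Prop :=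
  Tendsto (fun p : ℕ × ℕ => fortetMourierDist (μ p.1 p.2) (ν p.1 p.2))
    ((atTop ×ˢ atTop) ⊓ comap (fun p : ℕ × ℕ => φ p.1 p.2) (𝓝 0)) (𝓝 0)

/-- The covariance matrix used in `gaussianCounterpartLaw` is positive semidefinite, so that the
multivariate Gaussian law there is the genuine one. -/
theorem wishartCov_posSemidef {Ω : Type*} [MeasurableSpace Ω] {P : Measure Ω}
    [IsProbabilityMeasure P] {s : ℤ → ℝ} {X : ℕ → ℕ → Ω → ℝ}
    (hX : IsRowIndepGaussianArray s X P) (n d : ℕ) : (wishartCov X P n d).PosSemidef := by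
  have hL4 : ∀ i j, MemLp (X i j) 4 P := fun i j =>
    (hX.gaussian.hasGaussianLaw_eval (i, j)).memLp (by norm_num)
  have hent : ∀ p : Fin n × Fin n, MemLp (fun ω => wishart X n d ω p.1 p.2) 2 P := by
    intro p
    have h1 : ∀ k : Fin d, MemLp (fun ω => X p.1 k ω * X p.2 k ω) 2 P := by
      intro k
      have : ENNReal.HolderTriple 4 4 2 := by
        constructor
        rw [← two_mul, show (4 : ℝ≥0∞) = 2 * 2 by norm_num,
          ENNReal.mul_inv (by simp) (by simp), ← mul_assoc,
          ENNReal.mul_inv_cancel (by simp) (by simp), one_mul]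
      exact MemLp.mul (p := 4) (q := 4) (r := 2) (hL4 _ _) (hL4 _ _)
    have h2 : MemLp (fun ω => ∑ k : Fin d, X p.1 k ω * X p.2 k ω) 2 P :=
      memLp_finsetSum _ fun k _ => h1 k
    have h3 := ((h2.const_mul (1 / (d : ℝ))).sub
      (memLp_const ((1 : Matrix (Fin n) (Fin n) ℝ) p.1 p.2))).const_mul (√(d : ℝ))
    refine h3.congr_norm ?_ ?_
    · refine h3.1.congr (Eventually.of_forall fun ω => ?_)
      simp [wishart, dataMatrix, Matrix.mul_apply]
    · refine Eventually.of_forall fun ω => ?_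
      simp [wishart, dataMatrix, Matrix.mul_apply]
  refine Matrix.PosSemidef.of_dotProduct_mulVec_nonneg ?_ fun x => ?_
  · ext p q
    simp [wishartCov, Matrix.conjTranspose_apply, covariance_comm]
  · have key : star x ⬝ᵥ (wishartCov X P n d).mulVec x
        = Var[fun ω => ∑ p, x p * wishart X n d ω p.1 p.2; P] := by
      rw [← covariance_self (memLp_finsetSum _ fun p _ => (hent p).const_mul (x p)).1.aemeasurable,
        covariance_fun_sum_fun_sum (fun p => (hent p).const_mul (x p))
          (fun p => (hent p).const_mul (x p))]
      simp only [dotProduct, Matrix.mulVec, wishartCov, Matrix.of_apply, Finset.mul_sum,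
        covariance_const_mul_left, covariance_const_mul_right, Pi.star_apply, star_trivial]
      exact Finset.sum_congr rfl fun p _ => Finset.sum_congr rfl fun q _ => by ring
    rw [key]
    exact variance_nonneg _ _

end

/-! Let `T` be the `d × d` Toeplitz matrix of `s`, with eigenvalues `lam k`. Each row is a Gaussian
vector with covariance `T`, so in an eigenbasis of `T` the normalized Wishart matrix has the law of
`∑ k, a k (x k x kᵀ - I)`, with `a k = lam k / √d` and independent standard Gaussian columns `x k`
(`exists_wishartLaw_eq`). Its covariance is that of `σ (z + zᵀ) / √2` with `σ² = ∑ a k ² = tr T² /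
d`. Hence the Gaussian counterpart is again a GOE-type matrix (`gaussianCounterpartLaw_eq`), and
everything reduces to estimates of `tr T²` and `tr T⁴`.

Wishart against counterpart: interpolate by `cos θ W + sin θ G` with `W`, `G` independent. Gaussian
integration by parts in the entries of `x` produces second derivatives of the test function, which a
Lipschitz bound does not control. A second integration by parts, run backwards in the entries of
`z`, turns them into first derivatives. What remains is the first derivative applied to the
symmetrization of `z` times the defect `σ² I - ∑ a k ² x k x kᵀ`, whose entries have second moment
at most `2 ∑ a k ⁴`. Integrating over `θ` bounds the distance by `π √(n³ ∑ a k ⁴ / ∑ a k ²)`, where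
`∑ a k ⁴ = tr T⁴ / d²` (`fortetMourierDist_wishartLaw`).

Counterpart against GOE: using the same `z` for both, the distance is at most `2 n |σ - ‖s‖|`.

Traces: `|s k| ≤ 8 (|k| + 1) ^ (2H - 2)` by a second-order mean value formula. A Young-type
inequality gives `tr T⁴ ≤ d (2 ∑ |s j| ^ (4/3))³` up to constants. The last sum is bounded,
logarithmic or of order `d ^ ((8H - 5)/3)` according as `H` is below, at or above `5/8`. Further,
`tr T² / d` is the Cesàro mean of the partial sums of `‖s‖²`. It is at least `1`, it differs from
`‖s‖²` by an average of tails when `H < 3/4`, and it grows at least like `log d` at `H = 3/4`, which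
is the gain in the last case. -/

/-! ### Functions with moments of all orders -/

/-- `f` has finite moments of all orders. -/
def HasAllMoments {α : Type*} [MeasurableSpace α] (f : α → ℝ) (μ : Measure α) : Prop :=
  ∀ p : ℝ≥0∞, p ≠ ∞ → MemLp f p μ

namespace HasAllMoments

variable {α : Type*} [MeasurableSpace α] {μ : Measure α} {f g : α → ℝ}

theorem integrable (hf : HasAllMoments f μ) : Integrable f μ :=
  memLp_one_iff_integrable.1 (hf 1 (by simp))

theorem memLp_two (hf : HasAllMoments f μ) : MemLp f 2 μ := hf 2 (by simp)

/-- Hölder with exponents `2p, 2p, p` loses moments, so stability under products requires all orders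
at once. -/
theorem mul (hf : HasAllMoments f μ) (hg : HasAllMoments g μ) :
    HasAllMoments (fun x => f x * g x) μ := by
  intro p hp
  have : ENNReal.HolderTriple (2 * p) (2 * p) p := by
    constructor
    rw [← two_mul, ENNReal.mul_inv (by simp) (by simp), ← mul_assoc,
      ENNReal.mul_inv_cancel (by simp) (by simp), one_mul]
  exact MemLp.mul (p := 2 * p) (q := 2 * p) (r := p)
    (hg _ (ENNReal.mul_ne_top (by simp) hp)) (hf _ (ENNReal.mul_ne_top (by simp) hp))

theorem add (hf : HasAllMoments f μ) (hg : HasAllMoments g μ) :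
    HasAllMoments (fun x => f x + g x) μ := fun p hp => (hf p hp).add (hg p hp)

theorem sub (hf : HasAllMoments f μ) (hg : HasAllMoments g μ) :
    HasAllMoments (fun x => f x - g x) μ := fun p hp => (hf p hp).sub (hg p hp)

theorem const [IsFiniteMeasure μ] (c : ℝ) : HasAllMoments (fun _ : α => c) μ :=
  fun _ _ => memLp_const c

theorem const_mul (hf : HasAllMoments f μ) (c : ℝ) : HasAllMoments (fun x => c * f x) μ :=
  fun p hp => (hf p hp).const_mul c

theorem sum {β : Type*} (s : Finset β) {F : β → α → ℝ} (hF : ∀ i, HasAllMoments (F i) μ) :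
    HasAllMoments (fun x => ∑ i ∈ s, F i x) μ :=
  fun p hp => memLp_finsetSum s fun i _ => hF i p hp

theorem of_bound [IsFiniteMeasure μ] (hf : AEStronglyMeasurable f μ) {C : ℝ}
    (hC : ∀ x, |f x| ≤ C) : HasAllMoments f μ :=
  fun _ _ => MemLp.of_bound hf C (Eventually.of_forall hC)

theorem comp {β : Type*} [MeasurableSpace β] {ν : Measure β} {h : α → β}
    {k : β → ℝ} (hk : HasAllMoments k ν) (hh : MeasurePreserving h μ ν) :
    HasAllMoments (fun x => k (h x)) μ :=
  fun p hp => (hk p hp).comp_measurePreserving hh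

end HasAllMoments

/-! ### The standard Gaussian product measure and integration by parts -/

/-- The standard Gaussian product measure on `ι → ℝ`. -/
noncomputable abbrev stdGaussianPi (ι : Type*) [Fintype ι] : Measure (ι → ℝ) :=
  Measure.pi fun _ : ι => gaussianReal 0 1

theorem hasAllMoments_eval {ι : Type*} [Fintype ι] (i : ι) :
    HasAllMoments (fun x : ι → ℝ => x i) (stdGaussianPi ι) := by
  have h : HasAllMoments (fun x : ℝ => x) (gaussianReal 0 1) :=
    fun p hp => memLp_id_gaussianReal' p hp
  exact h.comp (measurePreserving_eval (fun _ : ι => gaussianReal 0 1) i)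

theorem hasDerivAt_gaussianPDFReal (x : ℝ) :
    HasDerivAt (gaussianPDFReal 0 1) (-x * gaussianPDFReal 0 1 x) x := by
  have h := (((hasDerivAt_id x).pow 2).neg.div_const 2).exp.const_mul (√(2 * Real.pi))⁻¹
  refine (h.congr_of_eventuallyEq (Eventually.of_forall fun y => ?_)).congr_deriv ?_
  · simp [gaussianPDFReal]
  · simp [gaussianPDFReal]; ring

/-- Integration by parts for the standard Gaussian law on `ℝ`. -/
theorem integral_mul_gaussianReal {f f' : ℝ → ℝ} (hf : ∀ x, HasDerivAt f (f' x) x)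
    (h0 : Integrable f (gaussianReal 0 1)) (h1 : Integrable f' (gaussianReal 0 1))
    (h2 : Integrable (fun x => x * f x) (gaussianReal 0 1)) :
    ∫ x, x * f x ∂(gaussianReal 0 1) = ∫ x, f' x ∂(gaussianReal 0 1) := by
  have hI : ∀ k : ℝ → ℝ, Integrable k (gaussianReal 0 1) →
      Integrable (fun x => k x * gaussianPDFReal 0 1 x) := by
    intro k hk
    rw [gaussianReal_of_var_ne_zero 0 one_ne_zero,
      integrable_withDensity_iff (measurable_gaussianPDF 0 1)
        (Eventually.of_forall fun x => gaussianPDF_lt_top)] at hk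
    simpa [toReal_gaussianPDF] using hk
  -- The Gaussian density has derivative `-x` times itself; integrability of all the products makes
  -- the boundary terms vanish.
  have key := integral_mul_deriv_eq_deriv_mul_of_integrable (u := f) (u' := f')
    (v := gaussianPDFReal 0 1) (v' := fun x => -x * gaussianPDFReal 0 1 x)
    (fun x _ => hf x) (fun x _ => hasDerivAt_gaussianPDFReal x)
    ((hI _ h2).neg.congr (Eventually.of_forall fun x => by simp; ring))
    (hI _ h1) (hI _ h0)
  rw [integral_gaussianReal_eq_integral_smul one_ne_zero,
    integral_gaussianReal_eq_integral_smul one_ne_zero]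
  simp only [smul_eq_mul]
  have e1 : ∫ x, gaussianPDFReal 0 1 x * (x * f x) = - ∫ x, f x * (-x * gaussianPDFReal 0 1 x) := by
    rw [← integral_neg]; congr 1; ext x; ring
  rw [e1, key, neg_neg]
  congr 1; ext x; ring

/-- Resampling one coordinate preserves a product law. -/
theorem measurePreserving_update {ι : Type*} [Fintype ι] [DecidableEq ι] (i : ι) :
    MeasurePreserving (fun p : (ι → ℝ) × ℝ => Function.update p.1 i p.2)
      ((stdGaussianPi ι).prod (gaussianReal 0 1)) (stdGaussianPi ι) := by
  have hm : Measurable (fun p : (ι → ℝ) × ℝ => Function.update p.1 i p.2) := by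
    refine measurable_pi_iff.2 fun j => ?_
    by_cases h : j = i
    · subst h; simpa using measurable_snd
    · simp only [Function.update_of_ne h]; fun_prop
  refine ⟨hm, (Measure.pi_eq fun s hs => ?_).symm⟩
  rw [Measure.map_apply hm (MeasurableSet.univ_pi hs)]
  have : (fun p : (ι → ℝ) × ℝ => Function.update p.1 i p.2) ⁻¹' (Set.univ.pi s)
      = (Set.univ.pi (Function.update s i Set.univ)) ×ˢ s i := by
    ext ⟨x, t⟩
    simp only [Set.mem_preimage, Set.mem_pi, Set.mem_univ, true_imp_iff, Set.mem_prod]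
    constructor
    · intro h
      refine ⟨fun j => ?_, by simpa using h i⟩
      by_cases hj : j = i
      · subst hj; simp
      · simpa [hj] using h j
    · rintro ⟨h, h'⟩ j
      by_cases hj : j = i
      · subst hj; simpa using h'
      · simpa [hj] using h j
  rw [this, Measure.prod_prod, Measure.pi_pi,
    ← Finset.mul_prod_erase Finset.univ (fun j => gaussianReal 0 1 (s j)) (Finset.mem_univ i),
    ← Finset.mul_prod_erase Finset.univ _ (Finset.mem_univ i)]
  simp only [Function.update_self, measure_univ, one_mul]
  rw [mul_comm]
  congr 1
  refine Finset.prod_congr rfl fun j hj => ?_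
  rw [Function.update_of_ne (Finset.ne_of_mem_erase hj)]

/-- Gaussian integration by parts in one coordinate of a standard Gaussian vector. -/
theorem integral_eval_mul {ι : Type*} [Fintype ι] [DecidableEq ι] (i : ι) {F F' : (ι → ℝ) → ℝ}
    (hF : ∀ x, HasDerivAt (fun t => F (Function.update x i t)) (F' x) (x i))
    (h0 : HasAllMoments F (stdGaussianPi ι)) (h1 : HasAllMoments F' (stdGaussianPi ι)) :
    ∫ x, x i * F x ∂(stdGaussianPi ι) = ∫ x, F' x ∂(stdGaussianPi ι) := by
  have hu := measurePreserving_update i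
  have h2 : Integrable (fun x => x i * F x) (stdGaussianPi ι) :=
    ((hasAllMoments_eval i).mul h0).integrable
  have k0 := (hu.integrable_comp h0.integrable.1).2 h0.integrable
  have k1 := (hu.integrable_comp h1.integrable.1).2 h1.integrable
  have k2 := (hu.integrable_comp h2.1).2 h2
  -- Resample the `i`-th coordinate by an independent copy. By Fubini, the one-dimensional formula
  -- then applies on almost every line in direction `i`.
  have tr : ∀ k : (ι → ℝ) → ℝ, AEStronglyMeasurable k (stdGaussianPi ι) →
      ∫ x, k x ∂(stdGaussianPi ι)
      = ∫ p, k (Function.update p.1 i p.2) ∂((stdGaussianPi ι).prod (gaussianReal 0 1)) := by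
    intro k hk
    conv_lhs => rw [← hu.map_eq]
    rw [integral_map hu.measurable.aemeasurable (by rwa [hu.map_eq])]
  simp only [Function.comp_def] at k0 k1 k2
  rw [tr _ h2.1, tr _ h1.integrable.1, integral_prod _ k2, integral_prod _ k1]
  refine integral_congr_ae ?_
  filter_upwards [k0.prod_right_ae, k1.prod_right_ae, k2.prod_right_ae] with x a0 a1 a2
  simp only [Function.update_self] at a0 a1 a2 ⊢
  refine integral_mul_gaussianReal (fun t => ?_) a0 a1 a2
  simpa using hF (Function.update x i t)

theorem hasDerivAt_update_eval {ι : Type*} [DecidableEq ι] (x : ι → ℝ) (i j : ι) :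
    HasDerivAt (fun t => Function.update x i t j) (if i = j then 1 else 0) (x i) := by
  by_cases h : i = j
  · subst h; simpa using hasDerivAt_id' (x i)
  · simpa [Function.update_of_ne (Ne.symm h), h] using hasDerivAt_const (x i) (x j)

/-! ### Moments of order at most four -/

section Wick

variable {ι : Type*} [Fintype ι] [DecidableEq ι]

theorem integral_eval_stdGaussianPi (a : ι) : ∫ x, x a ∂(stdGaussianPi ι) = 0 := by
  have := integral_eval_mul (ι := ι) a (F := fun _ => 1) (F' := fun _ => 0)
    (fun x => hasDerivAt_const _ _) (.const 1) (.const 0)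
  simpa using this

theorem integral_eval_mul_eval (a b : ι) :
    ∫ x, x a * x b ∂(stdGaussianPi ι) = if a = b then 1 else 0 := by
  rw [integral_eval_mul a (F := fun x => x b) (fun x => hasDerivAt_update_eval x a b)
    (hasAllMoments_eval b) (.const _)]
  simp

/-- One integration by parts in `x a` pairs `a` with each of the other indices; the two remaining
coordinates contribute a second moment. -/
theorem integral_wick_four (a b c e : ι) :
    ∫ x, x a * (x b * (x c * x e)) ∂(stdGaussianPi ι) =
      (if a = b then 1 else 0) * (if c = e then 1 else 0)
      + ((if a = c then 1 else 0) * (if b = e then 1 else 0)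
      + (if a = e then 1 else 0) * (if b = c then 1 else 0)) := by
  have hE := fun i : ι => hasAllMoments_eval i
  have hi : ∀ (r : ℝ) (i j : ι), HasAllMoments (fun x : ι → ℝ => r * (x i * x j))
      (stdGaussianPi ι) := fun r i j => ((hE i).mul (hE j)).const_mul r
  rw [integral_eval_mul a (F := fun x => x b * (x c * x e))
    (F' := fun x => (if a = b then 1 else 0) * (x c * x e)
      + ((if a = c then 1 else 0) * (x b * x e) + (if a = e then 1 else 0) * (x b * x c)))
    (fun x => ?_) ((hE b).mul ((hE c).mul (hE e)))
    ((hi _ _ _).add ((hi _ _ _).add (hi _ _ _))),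
    integral_add (hi _ _ _).integrable ((hi _ _ _).add (hi _ _ _)).integrable,
    integral_add (hi _ _ _).integrable (hi _ _ _).integrable]
  · simp only [integral_const_mul, integral_eval_mul_eval]
  · refine ((hasDerivAt_update_eval x a b).mul
      ((hasDerivAt_update_eval x a c).mul (hasDerivAt_update_eval x a e))).congr_deriv ?_
    simp only [Function.update_eq_self, Pi.mul_apply]
    ring

end Wick

/-! ### The random matrices of the interpolation -/

section Matrices

variable {n d : ℕ}

/-- The symmetric matrix `e i j + e j i`. -/
noncomputable def symUnit (i j : Fin n) : HSMatrix n :=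
  EuclideanSpace.single (i, j) 1 + EuclideanSpace.single (j, i) 1

theorem symUnit_comm (i j : Fin n) : symUnit i j = symUnit j i := add_comm _ _

/-- The matrix `∑ k, a k (x k x kᵀ - I)`, where `x k` is the `k`-th column of `x`. -/
noncomputable def chaosMatrix (a : Fin d → ℝ) (x : Fin n × Fin d → ℝ) : HSMatrix n :=
  (1 / 2 : ℝ) • ∑ i, ∑ j, (∑ k, a k * (x (i, k) * x (j, k) - if i = j then 1 else 0)) • symUnit i j

/-- The symmetric matrix `σ (z + zᵀ) / √2`. -/
noncomputable def goeMatrix (σ : ℝ) (z : Fin n × Fin n → ℝ) : HSMatrix n :=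
  (σ / √2) • ∑ i, ∑ j, z (i, j) • symUnit i j

theorem symUnit_apply (i j p q : Fin n) :
    symUnit i j (p, q) = (if i = p then 1 else 0) * (if j = q then 1 else 0)
      + (if j = p then 1 else 0) * (if i = q then 1 else 0) := by
  rw [symUnit, PiLp.add_apply, PiLp.single_apply, PiLp.single_apply]
  simp only [Prod.mk.injEq, ← ite_and, ite_mul, one_mul, zero_mul, @eq_comm _ p, @eq_comm _ q]

theorem sum_smul_symUnit_apply (w : Fin n → Fin n → ℝ) (p q : Fin n) :
    (∑ i, ∑ j, w i j • symUnit i j) (p, q) = w p q + w q p := by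
  simp only [WithLp.ofLp_sum, Finset.sum_apply, PiLp.smul_apply, smul_eq_mul, symUnit_apply,
    mul_add, Finset.sum_add_distrib]
  simp

/-- The sum over ordered pairs meets each entry twice, which the factor `1 / 2` in `chaosMatrix`
compensates. -/
theorem chaosMatrix_apply (a : Fin d → ℝ) (x : Fin n × Fin d → ℝ) (p q : Fin n) :
    chaosMatrix a x (p, q) = ∑ k, a k * (x (p, k) * x (q, k) - if p = q then 1 else 0) := by
  rw [chaosMatrix, PiLp.smul_apply, sum_smul_symUnit_apply]
  simp only [mul_comm (x (q, _)), eq_comm (a := q), smul_eq_mul]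
  ring

theorem goeMatrix_apply (σ : ℝ) (z : Fin n × Fin n → ℝ) (p q : Fin n) :
    goeMatrix σ z (p, q) = σ / √2 * (z (p, q) + z (q, p)) := by
  rw [goeMatrix, PiLp.smul_apply, sum_smul_symUnit_apply (fun i j => z (i, j)), smul_eq_mul]

theorem norm_sum_smul_symUnit_le (w : Fin n → Fin n → ℝ) :
    ‖∑ i, ∑ j, w i j • symUnit i j‖ ≤ 2 * √(∑ i, ∑ j, w i j ^ 2) := by
  refine Real.le_sqrt_of_sq_le ?_ |>.trans
    (b := √(2 ^ 2 * ∑ i, ∑ j, w i j ^ 2)) ?_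
  · rw [EuclideanSpace.real_norm_sq_eq, Fintype.sum_prod_type]
    simp only [sum_smul_symUnit_apply]
    have h : ∑ i, ∑ j, (w i j + w j i) ^ 2 ≤ ∑ i, ∑ j, (2 * w i j ^ 2 + 2 * w j i ^ 2) :=
      Finset.sum_le_sum fun i _ => Finset.sum_le_sum fun j _ => by
        nlinarith [sq_nonneg (w i j - w j i)]
    refine h.trans (le_of_eq ?_)
    simp only [Finset.sum_add_distrib, ← Finset.mul_sum]
    rw [Finset.sum_comm (f := fun i j => w j i ^ 2)]
    ring
  · rw [Real.sqrt_mul (by norm_num), Real.sqrt_sq (by norm_num)]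

theorem continuous_chaosMatrix (a : Fin d → ℝ) :
    Continuous (chaosMatrix (n := n) a) := by
  unfold chaosMatrix; fun_prop

theorem continuous_goeMatrix (σ : ℝ) : Continuous (goeMatrix (n := n) σ) := by
  unfold goeMatrix; fun_prop

theorem norm_goeMatrix_le (σ : ℝ) (z : Fin n × Fin n → ℝ) :
    ‖goeMatrix σ z‖ ≤ |σ| / √2 * (2 * √(∑ i, ∑ j, z (i, j) ^ 2)) := by
  rw [goeMatrix, norm_smul, Real.norm_eq_abs, abs_div, abs_of_nonneg (Real.sqrt_nonneg 2)]
  gcongr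
  exact norm_sum_smul_symUnit_le fun i j => z (i, j)

/-! ### Derivatives of the interpolation in the coordinates -/

/-- The interpolation `c W + s G` as a function of all Gaussian coordinates. -/
noncomputable def interpMatrix (a : Fin d → ℝ) (σ c s : ℝ)
    (x : (Fin n × Fin d) ⊕ (Fin n × Fin n) → ℝ) : HSMatrix n :=
  c • chaosMatrix a (fun p => x (.inl p)) + s • goeMatrix σ (fun p => x (.inr p))

theorem continuous_interpMatrix (a : Fin d → ℝ) (σ c s : ℝ) :
    Continuous (interpMatrix (n := n) a σ c s) := by
  have h1 := continuous_chaosMatrix (n := n) a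
  have h2 := continuous_goeMatrix (n := n) σ
  unfold interpMatrix
  fun_prop

theorem hasDerivAt_interpMatrix_inr (a : Fin d → ℝ) (σ c s : ℝ)
    (x : (Fin n × Fin d) ⊕ (Fin n × Fin n) → ℝ) (i m : Fin n) :
    HasDerivAt (fun t => interpMatrix a σ c s (Function.update x (.inr (i, m)) t))
      ((s * (σ / √2)) • symUnit i m) (x (.inr (i, m))) := by
  have h : HasDerivAt (fun t => ∑ p, ∑ q,
      Function.update x (.inr (i, m)) t (.inr (p, q)) • symUnit p q)
      (∑ p, ∑ q, (if (Sum.inr (i, m) : (Fin n × Fin d) ⊕ (Fin n × Fin n)) = .inr (p, q)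
        then (1 : ℝ) else 0) • symUnit p q) (x (.inr (i, m))) :=
    HasDerivAt.fun_sum fun p _ => HasDerivAt.fun_sum fun q _ =>
      (hasDerivAt_update_eval x _ _).smul_const _
  have h' := ((h.const_smul (σ / √2)).const_smul s).const_add
    (c • chaosMatrix a (fun p => x (.inl p)))
  refine (h'.congr_of_eventuallyEq (Eventually.of_forall fun t => ?_)).congr_deriv ?_
  · simp [interpMatrix, goeMatrix]
  · rw [smul_smul]
    congr 1
    rw [Finset.sum_eq_single i, Finset.sum_eq_single m]
    · simp
    · intro q _ hq; simp [Ne.symm hq]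
    · simp
    · intro p _ hp; simp [Ne.symm hp]
    · simp

/-- Column `l` enters quadratically, so both factors contribute. By the symmetry of `symUnit` the
contributions coincide, which cancels the `1 / 2`. -/
theorem hasDerivAt_interpMatrix_inl (a : Fin d → ℝ) (σ c s : ℝ)
    (x : (Fin n × Fin d) ⊕ (Fin n × Fin n) → ℝ) (i : Fin n) (l : Fin d) :
    HasDerivAt (fun t => interpMatrix a σ c s (Function.update x (.inl (i, l)) t))
      ((c * a l) • ∑ m, x (.inl (m, l)) • symUnit i m) (x (.inl (i, l))) := by
  have h : HasDerivAt (fun t => ∑ p, ∑ q,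
      (∑ k, a k * (Function.update x (.inl (i, l)) t (.inl (p, k))
        * Function.update x (.inl (i, l)) t (.inl (q, k)) - if p = q then 1 else 0)) • symUnit p q)
      (∑ p, ∑ q, (∑ k, a k * (
        (if (Sum.inl (i, l) : (Fin n × Fin d) ⊕ (Fin n × Fin n)) = .inl (p, k) then (1 : ℝ) else 0)
          * x (.inl (q, k)) + x (.inl (p, k)) *
        (if (Sum.inl (i, l) : (Fin n × Fin d) ⊕ (Fin n × Fin n)) = .inl (q, k) then (1 : ℝ) else 0)
          )) • symUnit p q) (x (.inl (i, l))) := by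
    refine HasDerivAt.fun_sum fun p _ => HasDerivAt.fun_sum fun q _ => HasDerivAt.smul_const
      (HasDerivAt.fun_sum fun k _ => HasDerivAt.const_mul _ ?_) _
    have := ((hasDerivAt_update_eval x (.inl (i, l)) (.inl (p, k))).mul
      (hasDerivAt_update_eval x (.inl (i, l)) (.inl (q, k)))).sub_const (if p = q then 1 else 0)
    simpa only [Function.update_eq_self, Pi.mul_apply] using! this
  have h' := ((h.const_smul (1 / 2 : ℝ)).const_smul c).add_const
    (s • goeMatrix σ (fun p => x (.inr p)))
  refine (h'.congr_of_eventuallyEq (Eventually.of_forall fun t => ?_)).congr_deriv ?_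
  · simp [interpMatrix, chaosMatrix]
  · have e : ∀ p q, (∑ k, a k * (
        (if (Sum.inl (i, l) : (Fin n × Fin d) ⊕ (Fin n × Fin n)) = .inl (p, k) then (1 : ℝ) else 0)
          * x (.inl (q, k)) + x (.inl (p, k)) *
        (if (Sum.inl (i, l) : (Fin n × Fin d) ⊕ (Fin n × Fin n)) = .inl (q, k) then (1 : ℝ) else 0)
          )) = (if i = p then a l * x (.inl (q, l)) else 0)
          + (if i = q then a l * x (.inl (p, l)) else 0) := by
      intro p q
      rw [Finset.sum_eq_single l]
      · simp only [Sum.inl.injEq, Prod.mk.injEq, and_true]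
        split_ifs <;> ring
      · intro k _ hk; simp [Ne.symm hk]
      · simp
    simp only [e, add_smul, Finset.sum_add_distrib, ite_smul, zero_smul]
    rw [Finset.sum_comm (f := fun p q => if i = p then (a l * x (.inl (q, l))) • symUnit p q else 0)]
    simp only [Finset.sum_ite_eq, Finset.mem_univ, if_true]
    simp only [symUnit_comm _ i, mul_smul, ← Finset.smul_sum]
    rw [← two_smul ℝ, smul_smul (1 / 2 : ℝ)]
    norm_num

end Matrices

/-! ### Integration by parts along the interpolation -/

section Interpolation

variable {n d : ℕ} {D : HSMatrix n → HSMatrix n →L[ℝ] ℝ}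
  {D2 : HSMatrix n → HSMatrix n →L[ℝ] HSMatrix n →L[ℝ] ℝ} {L K : ℝ}

theorem hasAllMoments_fderiv_interp (hD : Continuous D) (hL : ∀ A, ‖D A‖ ≤ L)
    (a : Fin d → ℝ) (σ c s : ℝ) (v : HSMatrix n) :
    HasAllMoments (fun x => D (interpMatrix a σ c s x) v) (stdGaussianPi _) := by
  have hc := continuous_interpMatrix (n := n) a σ c s
  refine HasAllMoments.of_bound (C := L * ‖v‖) ?_ fun x => ?_
  · exact Continuous.aestronglyMeasurable (by fun_prop)
  · exact (D _).le_of_opNorm_le (hL _) v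

theorem hasAllMoments_fderiv_two_interp (hD2 : Continuous D2) (hK : ∀ A, ‖D2 A‖ ≤ K)
    (a : Fin d → ℝ) (σ c s : ℝ) (u v : HSMatrix n) :
    HasAllMoments (fun x => D2 (interpMatrix a σ c s x) u v) (stdGaussianPi _) := by
  have hc := continuous_interpMatrix (n := n) a σ c s
  refine HasAllMoments.of_bound (C := K * ‖u‖ * ‖v‖) ?_ fun x => ?_
  · exact Continuous.aestronglyMeasurable (by fun_prop)
  · exact (D2 _).le_of_opNorm₂_le_of_le (hK _) le_rfl le_rfl

theorem hasDerivAt_fderiv_interp (hD : ∀ A, HasFDerivAt D (D2 A) A)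
    (a : Fin d → ℝ) (σ c s : ℝ) (v : HSMatrix n) (x : (Fin n × Fin d) ⊕ (Fin n × Fin n) → ℝ)
    (e : (Fin n × Fin d) ⊕ (Fin n × Fin n)) {w : HSMatrix n}
    (hw : HasDerivAt (fun t => interpMatrix a σ c s (Function.update x e t)) w (x e)) :
    HasDerivAt (fun t => D (interpMatrix a σ c s (Function.update x e t)) v)
      (D2 (interpMatrix a σ c s x) w v) (x e) := by
  have h1 : HasFDerivAt D (D2 (interpMatrix a σ c s x))
      (interpMatrix a σ c s (Function.update x e (x e))) := by
    rw [Function.update_eq_self]; exact hD _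
  have h2 := h1.comp_hasDerivAt (x e) hw
  simpa using (h2.clm_apply (hasDerivAt_const (x e) v))

/-- Read from right to left, this removes a second derivative in direction `symUnit i m` at the cost
of a Gaussian factor. The weight `ψ` may depend on all other coordinates. -/
theorem integral_inr_mul_fderiv (hD : ∀ A, HasFDerivAt D (D2 A) A) (hD2 : Continuous D2)
    (hL : ∀ A, ‖D A‖ ≤ L) (hK : ∀ A, ‖D2 A‖ ≤ K) (a : Fin d → ℝ) (σ c s : ℝ) (v : HSMatrix n)
    (i m : Fin n) {ψ : ((Fin n × Fin d) ⊕ (Fin n × Fin n) → ℝ) → ℝ}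
    (hψ : ∀ x t, ψ (Function.update x (.inr (i, m)) t) = ψ x)
    (hψ' : HasAllMoments ψ (stdGaussianPi _)) :
    ∫ x, x (.inr (i, m)) * (ψ x * D (interpMatrix a σ c s x) v) ∂(stdGaussianPi _)
      = s * (σ / √2) * ∫ x, ψ x * D2 (interpMatrix a σ c s x) (symUnit i m) v ∂(stdGaussianPi _) := by
  have hDc : Continuous D := continuous_iff_continuousAt.2 fun A => (hD A).continuousAt
  have h2 := hψ'.mul (hasAllMoments_fderiv_two_interp hD2 hK a σ c s (symUnit i m) v)
  rw [integral_eval_mul (Sum.inr (i, m))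
    (F' := fun x => s * (σ / √2) * (ψ x * D2 (interpMatrix a σ c s x) (symUnit i m) v))
    (fun x => ?_) (hψ'.mul (hasAllMoments_fderiv_interp hDc hL a σ c s v)) (h2.const_mul _),
    integral_const_mul]
  simp only [hψ]
  refine ((hasDerivAt_fderiv_interp hD a σ c s v x _
    (hasDerivAt_interpMatrix_inr a σ c s x i m)).const_mul (ψ x)).congr_deriv ?_
  simp; ring

/-- Integration by parts in `x (.inl (i, k))`: the derivative of the factor `x (.inl (j, k))` is
exactly the centring `δ i j`, so only second-derivative terms survive. -/
theorem integral_inl_mul_fderiv (hD : ∀ A, HasFDerivAt D (D2 A) A) (hD2 : Continuous D2)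
    (hL : ∀ A, ‖D A‖ ≤ L) (hK : ∀ A, ‖D2 A‖ ≤ K) (a : Fin d → ℝ) (σ c s : ℝ) (v : HSMatrix n)
    (i j : Fin n) (k : Fin d) :
    ∫ x, (x (.inl (i, k)) * x (.inl (j, k)) - if i = j then 1 else 0)
        * D (interpMatrix a σ c s x) v ∂(stdGaussianPi _)
      = c * a k * ∑ m, ∫ x, x (.inl (j, k)) * x (.inl (m, k)) *
          D2 (interpMatrix a σ c s x) (symUnit i m) v ∂(stdGaussianPi _) := by
  have hDc : Continuous D := continuous_iff_continuousAt.2 fun A => (hD A).continuousAt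
  have hE := fun e : (Fin n × Fin d) ⊕ (Fin n × Fin n) => hasAllMoments_eval e
  have h1 := hasAllMoments_fderiv_interp hDc hL a σ c s v
  have h2 := fun m => ((hE (.inl (j, k))).mul (hE (.inl (m, k)))).mul
    (hasAllMoments_fderiv_two_interp hD2 hK a σ c s (symUnit i m) v)
  have h3 : HasAllMoments (fun x : (Fin n × Fin d) ⊕ (Fin n × Fin n) → ℝ => c * a k * ∑ m,
      x (.inl (j, k)) * x (.inl (m, k)) * D2 (interpMatrix a σ c s x) (symUnit i m) v)
      (stdGaussianPi _) := (HasAllMoments.sum _ h2).const_mul _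
  have key := integral_eval_mul (Sum.inl (i, k))
    (F := fun x => x (.inl (j, k)) * D (interpMatrix a σ c s x) v)
    (F' := fun x => (if i = j then 1 else 0) * D (interpMatrix a σ c s x) v + c * a k * ∑ m,
      x (.inl (j, k)) * x (.inl (m, k)) * D2 (interpMatrix a σ c s x) (symUnit i m) v)
    (fun x => ?_) ((hE _).mul h1) ((h1.const_mul _).add h3)
  · rw [integral_add (h1.const_mul _).integrable h3.integrable, integral_const_mul, integral_const_mul,
      integral_finsetSum _ (fun m _ => (h2 m).integrable)] at key
    rw [← sub_eq_iff_eq_add', ← integral_const_mul,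
      ← integral_sub ((hE _).mul ((hE _).mul h1)).integrable (h1.const_mul _).integrable] at key
    rw [← key]
    congr 1; ext x; ring
  · refine ((hasDerivAt_update_eval x (.inl (i, k)) (.inl (j, k))).mul
      (hasDerivAt_fderiv_interp hD a σ c s v x _
      (hasDerivAt_interpMatrix_inl a σ c s x i k))).congr_deriv ?_
    simp only [Function.update_eq_self, map_smul, map_sum, smul_apply, sum_apply,
      smul_eq_mul, Finset.mul_sum, Sum.inl.injEq, Prod.mk.injEq, and_true]
    congr 1
    exact Finset.sum_congr rfl fun m _ => by ring

/-- The matrix `σ² - ∑ k, a k ² x k x kᵀ`. -/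
noncomputable def defect (a : Fin d → ℝ) (σ : ℝ) (x : (Fin n × Fin d) ⊕ (Fin n × Fin n) → ℝ)
    (j m : Fin n) : ℝ :=
  (if j = m then σ ^ 2 else 0) - ∑ k, a k ^ 2 * (x (.inl (j, k)) * x (.inl (m, k)))

theorem hasAllMoments_defect (a : Fin d → ℝ) (σ : ℝ) (j m : Fin n) :
    HasAllMoments (fun x => defect a σ x j m) (stdGaussianPi _) :=
  (HasAllMoments.const _).sub (HasAllMoments.sum _ fun _ =>
    ((hasAllMoments_eval _).mul (hasAllMoments_eval _)).const_mul _)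

/-- Two integrations by parts: forward in the `inl` coordinates, then backward in the `inr` ones, so
that only the first derivative `D` is left. The factor `s * (σ / √2)` stays on the left because `s`
vanishes at one end of the interpolation. -/
theorem integral_fderiv_chaosMatrix (hD : ∀ A, HasFDerivAt D (D2 A) A) (hD2 : Continuous D2)
    (hL : ∀ A, ‖D A‖ ≤ L) (hK : ∀ A, ‖D2 A‖ ≤ K) (a : Fin d → ℝ) (σ c s : ℝ) :
    s * (σ / √2) * ∫ x, D (interpMatrix a σ c s x) (chaosMatrix a fun p => x (.inl p))
        ∂(stdGaussianPi _) =
      c / 2 * ∑ i, ∑ j, ∑ m, ∑ k, ∫ x, x (.inr (i, m)) * (a k ^ 2 * (x (.inl (j, k)) *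
        x (.inl (m, k))) * D (interpMatrix a σ c s x) (symUnit i j)) ∂(stdGaussianPi _) := by
  have hDc : Continuous D := continuous_iff_continuousAt.2 fun A => (hD A).continuousAt
  have hE := fun e : (Fin n × Fin d) ⊕ (Fin n × Fin n) => hasAllMoments_eval e
  have h1 := hasAllMoments_fderiv_interp hDc hL a σ c s (n := n)
  have hx : ∀ (i j : Fin n) (k : Fin d), HasAllMoments
      (fun x : (Fin n × Fin d) ⊕ (Fin n × Fin n) → ℝ => a k *
        ((x (.inl (i, k)) * x (.inl (j, k)) - if i = j then 1 else 0)
        * D (interpMatrix a σ c s x) (symUnit i j))) (stdGaussianPi _) := fun i j k =>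
    ((((hE _).mul (hE _)).sub (.const _)).mul (h1 _)).const_mul _
  have e : ∀ x : (Fin n × Fin d) ⊕ (Fin n × Fin n) → ℝ,
      D (interpMatrix a σ c s x) (chaosMatrix a fun p => x (.inl p))
      = 1 / 2 * ∑ i, ∑ j, ∑ k, a k *
        ((x (.inl (i, k)) * x (.inl (j, k)) - if i = j then 1 else 0)
        * D (interpMatrix a σ c s x) (symUnit i j)) := by
    intro x
    simp only [chaosMatrix, map_smul, map_sum, smul_eq_mul, Finset.sum_mul, mul_assoc]
  simp only [e]
  rw [integral_const_mul, integral_finsetSum _ fun i _ => (HasAllMoments.sum _ fun j =>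
    HasAllMoments.sum _ fun k => hx i j k).integrable, ← mul_assoc, Finset.mul_sum, Finset.mul_sum]
  refine Finset.sum_congr rfl fun i _ => ?_
  rw [integral_finsetSum _ fun j _ => (HasAllMoments.sum _ fun k => hx i j k).integrable,
    Finset.mul_sum, Finset.mul_sum]
  refine Finset.sum_congr rfl fun j _ => ?_
  rw [integral_finsetSum _ fun k _ => (hx i j k).integrable, Finset.sum_comm, Finset.mul_sum,
    Finset.mul_sum]
  refine Finset.sum_congr rfl fun k _ => ?_
  rw [integral_const_mul, integral_inl_mul_fderiv hD hD2 hL hK, Finset.mul_sum, Finset.mul_sum,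
    Finset.mul_sum, Finset.mul_sum]
  refine Finset.sum_congr rfl fun m _ => ?_
  rw [integral_inr_mul_fderiv hD hD2 hL hK a σ c s _ i m
    (ψ := fun x => a k ^ 2 * (x (.inl (j, k)) * x (.inl (m, k)))) (fun x t => by simp)
    (((hE _).mul (hE _)).const_mul _)]
  simp only [mul_assoc (a k ^ 2), integral_const_mul]
  ring

/-- The derivative of the interpolation, expressed by the defect matrix. -/
theorem integral_fderiv_interp (hD : ∀ A, HasFDerivAt D (D2 A) A) (hD2 : Continuous D2)
    (hL : ∀ A, ‖D A‖ ≤ L) (hK : ∀ A, ‖D2 A‖ ≤ K) (a : Fin d → ℝ) {σ : ℝ} (hσ : σ ≠ 0) (c s : ℝ) :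
    ∫ x, D (interpMatrix a σ c s x) (-s • chaosMatrix a (fun p => x (.inl p)) +
        c • goeMatrix σ (fun p => x (.inr p))) ∂(stdGaussianPi _) =
      c / (√2 * σ) * ∫ x, D (interpMatrix a σ c s x) (∑ i, ∑ j,
        (∑ m, x (.inr (i, m)) * defect a σ x j m) • symUnit i j) ∂(stdGaussianPi _) := by
  have hDc : Continuous D := continuous_iff_continuousAt.2 fun A => (hD A).continuousAt
  have hE := fun e : (Fin n × Fin d) ⊕ (Fin n × Fin n) => hasAllMoments_eval e
  have h1 := hasAllMoments_fderiv_interp hDc hL a σ c s (n := n)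
  have key := integral_fderiv_chaosMatrix hD hD2 hL hK a σ c s
  have hG : ∀ i j : Fin n, HasAllMoments (fun x : (Fin n × Fin d) ⊕ (Fin n × Fin n) → ℝ =>
      x (.inr (i, j)) * D (interpMatrix a σ c s x) (symUnit i j)) (stdGaussianPi _) :=
    fun i j => (hE _).mul (h1 _)
  have eG : ∀ x : (Fin n × Fin d) ⊕ (Fin n × Fin n) → ℝ,
      D (interpMatrix a σ c s x) (goeMatrix σ fun p => x (.inr p))
      = σ / √2 * ∑ i, ∑ j, x (.inr (i, j)) * D (interpMatrix a σ c s x) (symUnit i j) := by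
    intro x
    simp only [goeMatrix, map_smul, map_sum, smul_eq_mul]
  have hW : HasAllMoments (fun x : (Fin n × Fin d) ⊕ (Fin n × Fin n) → ℝ =>
      D (interpMatrix a σ c s x) (chaosMatrix a fun p => x (.inl p))) (stdGaussianPi _) := by
    simp only [chaosMatrix, map_smul, map_sum, smul_eq_mul]
    exact (HasAllMoments.sum _ fun i => HasAllMoments.sum _ fun j => (HasAllMoments.sum _ fun k =>
      (((hE _).mul (hE _)).sub (.const _)).const_mul _).mul (h1 _)).const_mul _
  have hN : ∀ i j m : Fin n, HasAllMoments (fun x : (Fin n × Fin d) ⊕ (Fin n × Fin n) → ℝ =>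
      x (.inr (i, m)) * defect a σ x j m * D (interpMatrix a σ c s x) (symUnit i j))
      (stdGaussianPi _) := fun i j m => ((hE _).mul (hasAllMoments_defect _ _ _ _)).mul (h1 _)
  have hM : ∀ (i j m : Fin n) (k : Fin d), HasAllMoments
      (fun x : (Fin n × Fin d) ⊕ (Fin n × Fin n) → ℝ =>
      x (.inr (i, m)) * (a k ^ 2 * (x (.inl (j, k)) *
        x (.inl (m, k))) * D (interpMatrix a σ c s x) (symUnit i j)))
      (stdGaussianPi _) := fun i j m k => (hE _).mul ((((hE _).mul (hE _)).const_mul _).mul (h1 _))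
  have eN : ∀ i j m : Fin n, ∫ x, x (.inr (i, m)) * defect a σ x j m *
      D (interpMatrix a σ c s x) (symUnit i j) ∂(stdGaussianPi _)
      = (if j = m then σ ^ 2 * ∫ x, x (.inr (i, m)) * D (interpMatrix a σ c s x) (symUnit i j)
          ∂(stdGaussianPi _) else 0)
        - ∑ k, ∫ x, x (.inr (i, m)) * (a k ^ 2 * (x (.inl (j, k)) *
        x (.inl (m, k))) * D (interpMatrix a σ c s x) (symUnit i j)) ∂(stdGaussianPi _) := by
    intro i j m
    rw [← integral_finsetSum _ fun k _ => (hM i j m k).integrable]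
    have : (if j = m then σ ^ 2 * ∫ x, x (.inr (i, m)) * D (interpMatrix a σ c s x) (symUnit i j)
          ∂(stdGaussianPi _) else 0) = ∫ x, (if j = m then σ ^ 2 else 0) * (x (.inr (i, m)) *
          D (interpMatrix a σ c s x) (symUnit i j)) ∂(stdGaussianPi _) := by
      rw [integral_const_mul]; split_ifs <;> simp
    rw [this, ← integral_sub (((hE _).mul (h1 _)).const_mul _).integrable
      (HasAllMoments.sum _ fun k => hM i j m k).integrable]
    congr 1; ext x
    simp only [defect, mul_sub, sub_mul, Finset.mul_sum, Finset.sum_mul]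
    congr 1
    · ring
    · exact Finset.sum_congr rfl fun k _ => by ring
  simp only [map_add, map_smul, smul_eq_mul, map_sum, Finset.sum_mul]
  rw [integral_add (hW.const_mul _).integrable (by
    simp only [eG]
    exact ((HasAllMoments.sum _ fun i => HasAllMoments.sum _ fun j => hG i j).const_mul
      _ |>.const_mul _).integrable), integral_const_mul, integral_const_mul]
  simp only [eG]
  rw [integral_const_mul, integral_finsetSum _ fun i _ =>
    (HasAllMoments.sum _ fun j => hG i j).integrable, integral_finsetSum _ fun i _ =>
    (HasAllMoments.sum _ fun j => HasAllMoments.sum _ fun m => hN i j m).integrable]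
  simp only [integral_finsetSum _ fun j _ => (hG _ j).integrable,
    integral_finsetSum _ fun j _ => (HasAllMoments.sum _ fun m => hN _ j m).integrable,
    integral_finsetSum _ fun m _ => (hN _ _ m).integrable, eN, Finset.sum_sub_distrib,
    Finset.sum_ite_eq, Finset.mem_univ, if_true, ← Finset.mul_sum]
  have h2 : (√2 : ℝ) ≠ 0 := by positivity
  have h22 : √(2 : ℝ) ^ 2 = 2 := Real.sq_sqrt (by norm_num)
  set S1 := ∑ i, ∑ j, ∫ x, x (.inr (i, j)) * D (interpMatrix a σ c s x) (symUnit i j)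
    ∂(stdGaussianPi _)
  set S2 := ∑ i, ∑ j, ∑ m, ∑ k, ∫ x, x (.inr (i, m)) * (a k ^ 2 * (x (.inl (j, k)) *
        x (.inl (m, k))) * D (interpMatrix a σ c s x) (symUnit i j)) ∂(stdGaussianPi _)
  set I := ∫ x, D (interpMatrix a σ c s x) (chaosMatrix a fun p => x (.inl p)) ∂(stdGaussianPi _)
  -- The chaos part enters only through `s * I`, so no division by `s` is needed. The Gaussian part
  -- has coefficient `c σ / √2 = c / (√2 σ) * σ²`, which is the diagonal term of `defect`.
  have hI : s * I = c / (√2 * σ) * S2 := by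
    field_simp
    field_simp at key
    rw [← mul_right_inj' h2]
    linear_combination key + s * σ * I * h22
  rw [neg_mul, hI]
  field_simp
  ring

end Interpolation

/-! ### Smooth approximation of Lipschitz functions -/

section Mollify

open scoped Convolution ContDiff

variable {E : Type*} [NormedAddCommGroup E] [NormedSpace ℝ E] [FiniteDimensional ℝ E]
  [MeasurableSpace E] [BorelSpace E]

/-- Convolution with a Lipschitz function is Lipschitz. -/
theorem norm_convolution_sub_le {F G : Type*} [NormedAddCommGroup F] [NormedSpace ℝ F]
    [NormedAddCommGroup G] [NormedSpace ℝ G] {μ : Measure E} [μ.IsAddHaarMeasure]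
    (B : F →L[ℝ] ℝ →L[ℝ] G) {f : E → F} (hf : Continuous f) (hfc : HasCompactSupport f)
    {g : E → ℝ} {K : ℝ≥0} (hg : LipschitzWith K g) (x y : E) :
    ‖(f ⋆[B, μ] g) x - (f ⋆[B, μ] g) y‖ ≤ ‖B‖ * (∫ t, ‖f t‖ ∂μ) * K * ‖x - y‖ := by
  have hfi : Integrable f μ := hf.integrable_of_hasCompactSupport hfc
  have hex : ConvolutionExists f g B μ :=
    hfc.convolutionExists_left B hf hg.continuous.locallyIntegrable
  rw [convolution, convolution, ← integral_sub (hex x) (hex y)]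
  have hb : ∀ t, ‖B (f t) (g (x - t)) - B (f t) (g (y - t))‖ ≤ ‖B‖ * K * ‖x - y‖ * ‖f t‖ := by
    intro t
    rw [← map_sub]
    refine (B.le_opNorm₂ _ _).trans ?_
    have := hg.norm_sub_le (x - t) (y - t)
    rw [sub_sub_sub_cancel_right] at this
    calc _ ≤ ‖B‖ * ‖f t‖ * (K * ‖x - y‖) := by gcongr
      _ = _ := by ring
  refine (norm_integral_le_of_norm_le (hfi.norm.const_mul _) (Eventually.of_forall hb)).trans ?_
  rw [integral_const_mul]
  exact le_of_eq (by ring)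

set_option maxSynthPendingDepth 3 in
-- Convolution with a normalized bump keeps the Lipschitz constant, since the bump is a probability
-- density. The second derivative is bounded because the derivative of the bump, convolved with a
-- Lipschitz function, is Lipschitz. The bound `M` depends on `ε`, but it serves only for
-- integrability.
theorem exists_smooth_approx {g : E → ℝ} {K : ℝ≥0} (hg : LipschitzWith K g) {ε : ℝ} (hε : 0 < ε) :
    ∃ (h : E → ℝ) (D : E → E →L[ℝ] ℝ) (D2 : E → E →L[ℝ] E →L[ℝ] ℝ) (M : ℝ),
      (∀ x, |h x - g x| ≤ ε) ∧ (∀ x, HasFDerivAt h (D x) x) ∧ (∀ x, HasFDerivAt D (D2 x) x) ∧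
      Continuous D2 ∧ (∀ x, ‖D x‖ ≤ K) ∧ (∀ x, ‖D2 x‖ ≤ M) := by
  obtain ⟨δ, hδ, hδε⟩ : ∃ δ > 0, K * δ ≤ ε := by
    -- The `+ 1` covers `K = 0`.
    refine ⟨ε / (K + 1), by positivity, ?_⟩
    rw [← mul_div_assoc, div_le_iff₀ (by positivity)]
    nlinarith [K.2]
  let μ : Measure E := Measure.addHaar
  set φ : ContDiffBump (0 : E) := ⟨δ / 2, δ, half_pos hδ, half_lt_self hδ⟩
  have hloc : LocallyIntegrable g μ := hg.continuous.locallyIntegrable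
  set h : E → ℝ := φ.normed μ ⋆[ContinuousLinearMap.lsmul ℝ ℝ, μ] g
  have hsm : ContDiff ℝ ∞ h :=
    φ.hasCompactSupport_normed.contDiff_convolution_left _ φ.contDiff_normed hloc
  have hd : Differentiable ℝ h := hsm.differentiable (by simp)
  have hsm' : ContDiff ℝ 1 (fderiv ℝ h) := (hsm.of_le (m := 2) (by norm_cast)).fderiv_right (by norm_num)
  have hlip : LipschitzWith K h := by
    refine LipschitzWith.of_dist_le_mul fun x y => ?_
    rw [dist_eq_norm, dist_eq_norm]
    refine (norm_convolution_sub_le _ (φ.contDiff_normed (n := 0)).continuous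
      φ.hasCompactSupport_normed hg x y).trans ?_
    have h1 : ∫ t, ‖φ.normed μ t‖ ∂μ = 1 := by
      rw [← φ.integral_normed (μ := μ)]
      congr 1; ext t; exact Real.norm_of_nonneg (φ.nonneg_normed t)
    rw [h1, mul_one]
    have h2 := ContinuousLinearMap.opNorm_lsmul_le (𝕜 := ℝ) (R := ℝ) (E := ℝ)
    calc _ ≤ 1 * K * ‖x - y‖ := by gcongr
      _ = _ := by ring
  have hD : ∀ x, fderiv ℝ h x =
      (fderiv ℝ (φ.normed μ) ⋆[(ContinuousLinearMap.lsmul ℝ ℝ).precompL E, μ] g) x := fun x =>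
    (φ.hasCompactSupport_normed.hasFDerivAt_convolution_left _ φ.contDiff_normed hloc x).fderiv
  have hφc : Continuous (fderiv ℝ (φ.normed μ)) :=
    (φ.contDiff_normed (n := 1)).continuous_fderiv one_ne_zero
  let B : (E →L[ℝ] ℝ) →L[ℝ] ℝ →L[ℝ] (E →L[ℝ] ℝ) := (ContinuousLinearMap.lsmul ℝ ℝ).precompL E
  set C : ℝ := ‖B‖ * (∫ t, ‖fderiv ℝ (φ.normed μ) t‖ ∂μ) * K
  have hC : 0 ≤ C := by positivity
  have hDlip : LipschitzWith ⟨C, hC⟩ (fderiv ℝ h) := by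
    refine LipschitzWith.of_dist_le_mul fun x y => ?_
    rw [dist_eq_norm, dist_eq_norm, hD, hD]
    exact norm_convolution_sub_le B hφc (φ.hasCompactSupport_normed.fderiv ℝ) hg x y
  refine ⟨h, fderiv ℝ h, fderiv ℝ (fderiv ℝ h), C, fun x => ?_, fun x => (hd x).hasFDerivAt,
    fun x => ((hsm'.differentiable one_ne_zero) x).hasFDerivAt, hsm'.continuous_fderiv one_ne_zero,
    fun x => norm_fderiv_le_of_lipschitz ℝ hlip, fun x => norm_fderiv_le_of_lipschitz ℝ hDlip⟩
  refine φ.dist_normed_convolution_le hloc.aestronglyMeasurable fun y hy => ?_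
  refine (hg.dist_le_mul y x).trans (le_trans ?_ hδε)
  gcongr
  exact (Metric.mem_ball.1 hy).le

end Mollify

/-! ### Second moments -/

section SecondMoments

variable {n d : ℕ}

/-- Covariances of the products of two coordinates in the same column. -/
theorem integral_mul_column {ι : Type*} [Fintype ι] [DecidableEq ι] {e : Fin n × Fin d → ι}
    (he : Function.Injective e) (i j p q : Fin n) (k l : Fin d) :
    ∫ x, (x (e (i, k)) * x (e (j, k)) - if i = j then 1 else 0)
      * (x (e (p, l)) * x (e (q, l)) - if p = q then 1 else 0) ∂(stdGaussianPi ι)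
    = if k = l then ((if i = p then 1 else 0) * (if j = q then 1 else 0)
      + (if i = q then 1 else 0) * (if j = p then 1 else 0)) else 0 := by
  have hE := fun i : ι => hasAllMoments_eval i
  have hw := integral_wick_four (e (i, k)) (e (j, k)) (e (p, l)) (e (q, l))
  have h2 := integral_eval_mul_eval (e (i, k)) (e (j, k))
  have h3 := integral_eval_mul_eval (e (p, l)) (e (q, l))
  have hp := fun i j : ι => (hE i).mul (hE j)
  have e1 : ∀ x : ι → ℝ, (x (e (i, k)) * x (e (j, k)) - if i = j then 1 else 0)
      * (x (e (p, l)) * x (e (q, l)) - if p = q then 1 else 0)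
      = x (e (i, k)) * (x (e (j, k)) * (x (e (p, l)) * x (e (q, l))))
        - (if p = q then 1 else 0) * (x (e (i, k)) * x (e (j, k)))
        - ((if i = j then 1 else 0) * (x (e (p, l)) * x (e (q, l)))
        - (if i = j then 1 else 0) * (if p = q then 1 else 0)) := fun x => by ring
  simp only [e1]
  rw [integral_sub (((hE _).mul ((hE _).mul (hp _ _))).sub ((hp _ _).const_mul _)).integrable
    (((hp _ _).const_mul _).sub (.const _)).integrable,
    integral_sub ((hE _).mul ((hE _).mul (hp _ _))).integrable ((hp _ _).const_mul _).integrable,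
    integral_sub ((hp _ _).const_mul _).integrable (HasAllMoments.const _).integrable,
    integral_const_mul, integral_const_mul, hw, h2, h3]
  simp only [integral_const, probReal_univ, one_smul, he.eq_iff, Prod.mk.injEq]
  by_cases hkl : k = l <;> simp only [hkl, and_true, and_false, if_true, if_false] <;> ring

/-- Since `σ ^ 2 = ∑ a k ^ 2`, the defect is minus a sum of independent centred column terms, so
only the diagonal `k = l` contributes. The factor `2` is the variance of a squared standard
Gaussian, reached when `j = m`. -/
theorem integral_defect_sq (a : Fin d → ℝ) {σ : ℝ} (hσ : σ ^ 2 = ∑ k, a k ^ 2) (j m : Fin n) :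
    ∫ x, defect a σ x j m ^ 2 ∂(stdGaussianPi _) ≤ 2 * ∑ k, a k ^ 4 := by
  have hE := fun e : (Fin n × Fin d) ⊕ (Fin n × Fin n) => hasAllMoments_eval e
  have e1 : ∀ x : (Fin n × Fin d) ⊕ (Fin n × Fin n) → ℝ, defect a σ x j m ^ 2 =
      ∑ k, ∑ l, a k ^ 2 * a l ^ 2 *
        ((x (.inl (j, k)) * x (.inl (m, k)) - if j = m then 1 else 0)
        * (x (.inl (j, l)) * x (.inl (m, l)) - if j = m then 1 else 0)) := by
    intro x
    have : defect a σ x j m = - ∑ k, a k ^ 2 *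
        (x (.inl (j, k)) * x (.inl (m, k)) - if j = m then 1 else 0) := by
      simp only [defect, mul_sub, Finset.sum_sub_distrib, hσ]
      rw [neg_sub]
      congr 1
      split_ifs <;> simp
    rw [this, neg_sq, sq, Finset.sum_mul_sum]
    exact Finset.sum_congr rfl fun k _ => Finset.sum_congr rfl fun l _ => by ring
  have hi : ∀ k l, HasAllMoments (fun x : (Fin n × Fin d) ⊕ (Fin n × Fin n) → ℝ =>
      a k ^ 2 * a l ^ 2 * ((x (.inl (j, k)) * x (.inl (m, k)) - if j = m then 1 else 0)
        * (x (.inl (j, l)) * x (.inl (m, l)) - if j = m then 1 else 0))) (stdGaussianPi _) :=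
    fun k l => ((((hE _).mul (hE _)).sub (.const _)).mul
      (((hE _).mul (hE _)).sub (.const _))).const_mul _
  simp only [e1]
  rw [integral_finsetSum _ fun k _ => (HasAllMoments.sum _ fun l => hi k l).integrable,
    Finset.mul_sum]
  refine Finset.sum_le_sum fun k _ => ?_
  rw [integral_finsetSum _ fun l _ => (hi k l).integrable]
  simp only [integral_const_mul, integral_mul_column Sum.inl_injective, mul_ite, mul_zero,
    Finset.sum_ite_eq, Finset.mem_univ, if_true, mul_one]
  have : (0 : ℝ) ≤ a k ^ 4 := by positivity
  split_ifs <;> nlinarith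

/-- The defect depends only on the `inl` coordinates, so the independent `inr` factors kill the
cross terms `m ≠ m'`. -/
theorem integral_sum_mul_defect_sq (a : Fin d → ℝ) {σ : ℝ} (hσ : σ ^ 2 = ∑ k, a k ^ 2)
    (i j : Fin n) :
    ∫ x, (∑ m, x (.inr (i, m)) * defect a σ x j m) ^ 2 ∂(stdGaussianPi _)
      ≤ n * (2 * ∑ k, a k ^ 4) := by
  have hE := fun e : (Fin n × Fin d) ⊕ (Fin n × Fin n) => hasAllMoments_eval e
  have hR := hasAllMoments_defect (n := n) a σ
  have e1 : ∀ x : (Fin n × Fin d) ⊕ (Fin n × Fin n) → ℝ,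
      (∑ m, x (.inr (i, m)) * defect a σ x j m) ^ 2 = ∑ m, ∑ m', x (.inr (i, m)) *
        (x (.inr (i, m')) * (defect a σ x j m * defect a σ x j m')) := by
    intro x
    rw [sq, Finset.sum_mul_sum]
    exact Finset.sum_congr rfl fun k _ => Finset.sum_congr rfl fun l _ => by ring
  have hi : ∀ m m', HasAllMoments (fun x : (Fin n × Fin d) ⊕ (Fin n × Fin n) → ℝ => x (.inr (i, m)) *
        (x (.inr (i, m')) * (defect a σ x j m * defect a σ x j m'))) (stdGaussianPi _) :=
    fun m m' => (hE _).mul ((hE _).mul ((hR _ _).mul (hR _ _)))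
  have e2 : ∀ m m', ∫ x, x (.inr (i, m)) *
        (x (.inr (i, m')) * (defect a σ x j m * defect a σ x j m')) ∂(stdGaussianPi _)
        = if m = m' then ∫ x, defect a σ x j m ^ 2 ∂(stdGaussianPi _) else 0 := by
    intro m m'
    rw [integral_eval_mul (Sum.inr (i, m))
      (F' := fun x => (if m = m' then 1 else 0) * (defect a σ x j m * defect a σ x j m'))
      (fun x => ?_) ((hE _).mul ((hR _ _).mul (hR _ _))) (((hR _ _).mul (hR _ _)).const_mul _)]
    · rw [integral_const_mul]
      by_cases h : m = m'
      · subst h; simp [sq]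
      · simp [h]
    · have := (hasDerivAt_update_eval x (.inr (i, m)) (.inr (i, m'))).mul_const
        (defect a σ x j m * defect a σ x j m')
      simpa [defect] using this
  simp only [e1]
  rw [integral_finsetSum _ fun m _ => (HasAllMoments.sum _ fun m' => hi m m').integrable]
  simp only [integral_finsetSum _ fun m' _ => (hi _ m').integrable, e2, Finset.sum_ite_eq,
    Finset.mem_univ, if_true]
  refine (Finset.sum_le_sum fun m _ => integral_defect_sq a hσ j m).trans ?_
  simp

end SecondMoments

/-! ### The quantitative central limit theorem -/

section CLT

theorem integral_sqrt_le {α : Type*} [MeasurableSpace α] {μ : Measure α} [IsProbabilityMeasure μ]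
    {f : α → ℝ} (hf : Integrable f μ) (h0 : ∀ x, 0 ≤ f x) :
    Integrable (fun x => √(f x)) μ ∧ ∫ x, √(f x) ∂μ ≤ √(∫ x, f x ∂μ) := by
  have hi : Integrable (fun x => √(f x)) μ := by
    refine Integrable.mono' ((integrable_const 1).add hf)
      (Real.continuous_sqrt.comp_aestronglyMeasurable hf.1) (Eventually.of_forall fun x => ?_)
    rw [Real.norm_of_nonneg (Real.sqrt_nonneg _)]
    simp only [Pi.add_apply]
    nlinarith [Real.sq_sqrt (h0 x), sq_nonneg (√(f x) - 1)]
  exact ⟨hi, Real.strictConcaveOn_sqrt.concaveOn.le_map_integral Real.continuous_sqrt.continuousOn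
    isClosed_Ici (Eventually.of_forall h0) hf hi⟩

variable {n d : ℕ}

/-- Summing the previous second moments over `i, j` gives `2 n³ ∑ a k ^ 4`, and Jensen bounds the
mean norm. The resulting `√2` cancels the one in `c / (√2 * σ)`. -/
theorem abs_integral_fderiv_interp_le {D : HSMatrix n → HSMatrix n →L[ℝ] ℝ}
    {D2 : HSMatrix n → HSMatrix n →L[ℝ] HSMatrix n →L[ℝ] ℝ} {L K : ℝ}
    (hD : ∀ A, HasFDerivAt D (D2 A) A) (hD2 : Continuous D2)
    (hL : ∀ A, ‖D A‖ ≤ L) (hK : ∀ A, ‖D2 A‖ ≤ K) {a : Fin d → ℝ} {σ : ℝ} (hσ : 0 < σ)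
    (hσa : σ ^ 2 = ∑ k, a k ^ 2) {c : ℝ} (s : ℝ) (hc : |c| ≤ 1) :
    |∫ x, D (interpMatrix a σ c s x) (-s • chaosMatrix a (fun p => x (.inl p)) +
        c • goeMatrix σ (fun p => x (.inr p))) ∂(stdGaussianPi _)|
      ≤ 2 * L / σ * √(n ^ 3 * ∑ k, a k ^ 4) := by
  have hL0 : 0 ≤ L := (norm_nonneg _).trans (hL 0)
  rw [integral_fderiv_interp hD hD2 hL hK a hσ.ne' c s, abs_mul, abs_div,
    abs_of_pos (show 0 < √2 * σ by positivity)]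
  set w : ((Fin n × Fin d) ⊕ (Fin n × Fin n) → ℝ) → Fin n → Fin n → ℝ :=
    fun x i j => ∑ m, x (.inr (i, m)) * defect a σ x j m
  have hw : ∀ i j, HasAllMoments (fun x => w x i j ^ 2) (stdGaussianPi _) := fun i j => by
    simp only [sq]
    have := HasAllMoments.sum Finset.univ fun m =>
      (hasAllMoments_eval (.inr (i, m))).mul (hasAllMoments_defect (n := n) a σ j m)
    exact this.mul this
  have hS : HasAllMoments (fun x => ∑ i, ∑ j, w x i j ^ 2) (stdGaussianPi _) :=
    HasAllMoments.sum _ fun i => HasAllMoments.sum _ fun j => hw i j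
  obtain ⟨hi, hle⟩ := integral_sqrt_le hS.integrable fun x => by positivity
  have hint : ∫ x, ∑ i, ∑ j, w x i j ^ 2 ∂(stdGaussianPi _) ≤ 2 * (n ^ 3 * ∑ k, a k ^ 4) := by
    rw [integral_finsetSum _ fun i _ => (HasAllMoments.sum _ fun j => hw i j).integrable]
    simp only [integral_finsetSum _ fun j _ => (hw _ j).integrable]
    refine (Finset.sum_le_sum fun i _ => Finset.sum_le_sum fun j _ =>
      integral_sum_mul_defect_sq a hσa i j).trans (le_of_eq ?_)
    simp; ring
  have hb : |∫ x, D (interpMatrix a σ c s x) (∑ i, ∑ j, w x i j • symUnit i j)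
      ∂(stdGaussianPi _)| ≤ 2 * L * (√2 * √(n ^ 3 * ∑ k, a k ^ 4)) := by
    rw [← Real.norm_eq_abs]
    refine (norm_integral_le_of_norm_le (hi.const_mul (2 * L))
      (Eventually.of_forall fun x => ?_)).trans ?_
    · refine ((D (interpMatrix a σ c s x)).le_of_opNorm_le (hL _) _).trans ?_
      have := norm_sum_smul_symUnit_le (w x)
      calc _ ≤ L * (2 * √(∑ i, ∑ j, w x i j ^ 2)) := by gcongr
        _ = _ := by ring
    · rw [integral_const_mul, ← Real.sqrt_mul (by norm_num)]
      gcongr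
      exact hle.trans (Real.sqrt_le_sqrt hint)
  calc |c| / (√2 * σ) * _ ≤ 1 / (√2 * σ) * (2 * L * (√2 * √(n ^ 3 * ∑ k, a k ^ 4))) := by gcongr
    _ = _ := by field_simp

theorem integrable_norm_chaosMatrix (a : Fin d → ℝ) :
    Integrable (fun x : (Fin n × Fin d) ⊕ (Fin n × Fin n) → ℝ =>
      ‖chaosMatrix a fun p => x (.inl p)‖) (stdGaussianPi _) := by
  have h : Integrable (fun x : (Fin n × Fin d) ⊕ (Fin n × Fin n) → ℝ => ∑ i, ∑ j,
      (∑ k, a k * (x (.inl (i, k)) * x (.inl (j, k)) - if i = j then 1 else 0)) • symUnit i j)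
      (stdGaussianPi _) :=
    integrable_finsetSum _ fun i _ => integrable_finsetSum _ fun j _ => Integrable.smul_const
      (HasAllMoments.integrable (HasAllMoments.sum _ fun k =>
        (((hasAllMoments_eval _).mul (hasAllMoments_eval _)).sub (.const _)).const_mul _)) _
  exact (h.smul (1 / 2 : ℝ)).norm

theorem integrable_norm_goeMatrix (σ : ℝ) :
    Integrable (fun x : (Fin n × Fin d) ⊕ (Fin n × Fin n) → ℝ =>
      ‖goeMatrix σ fun p => x (.inr p)‖) (stdGaussianPi _) := by
  have h : Integrable (fun x : (Fin n × Fin d) ⊕ (Fin n × Fin n) → ℝ => ∑ i, ∑ j,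
      x (.inr (i, j)) • symUnit i j) (stdGaussianPi _) :=
    integrable_finsetSum _ fun i _ => integrable_finsetSum _ fun j _ =>
      Integrable.smul_const (hasAllMoments_eval _).integrable _
  exact (h.smul (σ / √2)).norm

theorem measurePreserving_inl {α β : Type*} [Fintype α] [Fintype β] :
    MeasurePreserving (fun (x : α ⊕ β → ℝ) (p : α) => x (.inl p))
      (stdGaussianPi (α ⊕ β)) (stdGaussianPi α) :=
  measurePreserving_fst.comp
    (measurePreserving_sumPiEquivProdPi fun _ : α ⊕ β => gaussianReal 0 1)

theorem measurePreserving_inr {α β : Type*} [Fintype α] [Fintype β] :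
    MeasurePreserving (fun (x : α ⊕ β → ℝ) (p : β) => x (.inr p))
      (stdGaussianPi (α ⊕ β)) (stdGaussianPi β) :=
  measurePreserving_snd.comp
    (measurePreserving_sumPiEquivProdPi fun _ : α ⊕ β => gaussianReal 0 1)

/-- The path `cos θ W + sin θ G` runs from `W` at `0` to `G` at `π / 2` with constant covariance.
The mean value inequality over this interval turns the derivative bound `2 * L / σ` into `π * L /
σ`. Neither `M` nor `K` enters the bound. -/
theorem abs_integral_chaos_sub_goe_le_of_smooth {g : HSMatrix n → ℝ}
    {D : HSMatrix n → HSMatrix n →L[ℝ] ℝ}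
    {D2 : HSMatrix n → HSMatrix n →L[ℝ] HSMatrix n →L[ℝ] ℝ} {L K M : ℝ}
    (hM : ∀ A, |g A| ≤ M) (hg : ∀ A, HasFDerivAt g (D A) A)
    (hD : ∀ A, HasFDerivAt D (D2 A) A) (hD2 : Continuous D2)
    (hL : ∀ A, ‖D A‖ ≤ L) (hK : ∀ A, ‖D2 A‖ ≤ K) {a : Fin d → ℝ} {σ : ℝ} (hσ : 0 < σ)
    (hσa : σ ^ 2 = ∑ k, a k ^ 2) :
    |∫ x, g (chaosMatrix a x) ∂(stdGaussianPi _) - ∫ z, g (goeMatrix σ z) ∂(stdGaussianPi _)|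
      ≤ Real.pi * L / σ * √(n ^ 3 * ∑ k, a k ^ 4) := by
  have hgc : Continuous g := continuous_iff_continuousAt.2 fun A => (hg A).continuousAt
  have hDc : Continuous D := continuous_iff_continuousAt.2 fun A => (hD A).continuousAt
  have hcW := continuous_chaosMatrix (n := n) a
  have hcG := continuous_goeMatrix (n := n) σ
  have hcI := continuous_interpMatrix (n := n) a σ
  set Ψ : ℝ → ℝ := fun θ => ∫ x, g (interpMatrix a σ (Real.cos θ) (Real.sin θ) x) ∂(stdGaussianPi _)
  have hder : ∀ θ, HasDerivAt Ψ (∫ x, D (interpMatrix a σ (Real.cos θ) (Real.sin θ) x)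
      (-Real.sin θ • chaosMatrix a (fun p => x (.inl p)) +
        Real.cos θ • goeMatrix σ (fun p => x (.inr p))) ∂(stdGaussianPi _)) θ := by
    intro θ
    refine (hasDerivAt_integral_of_dominated_loc_of_deriv_le (s := Set.univ)
      (bound := fun x => L * (‖chaosMatrix a fun p => x (.inl p)‖ + ‖goeMatrix σ fun p => x (.inr p)‖))
      (F' := fun θ x => D (interpMatrix a σ (Real.cos θ) (Real.sin θ) x)
      (-Real.sin θ • chaosMatrix a (fun p => x (.inl p)) +
        Real.cos θ • goeMatrix σ (fun p => x (.inr p))))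
      Filter.univ_mem (Eventually.of_forall fun θ => ?_) ?_ ?_ ?_ ?_ ?_).2
    · exact (hgc.comp (hcI _ _)).aestronglyMeasurable
    · exact (HasAllMoments.of_bound (hgc.comp (hcI _ _)).aestronglyMeasurable
        fun x => hM _).integrable
    · refine Continuous.aestronglyMeasurable (Continuous.clm_apply (hDc.comp (hcI _ _)) ?_)
      fun_prop
    · refine Eventually.of_forall fun x θ _ => ((D _).le_of_opNorm_le (hL _) _).trans ?_
      have hL0 : 0 ≤ L := (norm_nonneg _).trans (hL 0)
      gcongr
      refine (norm_add_le _ _).trans ?_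
      rw [norm_smul, norm_smul, norm_neg, Real.norm_eq_abs, Real.norm_eq_abs]
      exact add_le_add (mul_le_of_le_one_left (norm_nonneg _) (Real.abs_sin_le_one _))
        (mul_le_of_le_one_left (norm_nonneg _) (Real.abs_cos_le_one _))
    · exact ((integrable_norm_chaosMatrix a).add (integrable_norm_goeMatrix σ)).const_mul _
    · refine Eventually.of_forall fun x θ _ => (hg _).comp_hasDerivAt θ ?_
      exact ((Real.hasDerivAt_cos θ).smul_const _).add ((Real.hasDerivAt_sin θ).smul_const _)
  have hmv := norm_image_sub_le_of_norm_deriv_le_segment' (a := 0) (b := Real.pi / 2)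
    (fun θ _ => (hder θ).hasDerivWithinAt)
    (fun θ _ => abs_integral_fderiv_interp_le hD hD2 hL hK hσ hσa (Real.sin θ)
      (Real.abs_cos_le_one θ)) (Real.pi / 2) (Set.right_mem_Icc.2 (by positivity))
  have h0 : Ψ 0 = ∫ x, g (chaosMatrix a x) ∂(stdGaussianPi _) := by
    have hmp := measurePreserving_inl (α := Fin n × Fin d) (β := Fin n × Fin n)
    have hgW : Continuous fun x => g (chaosMatrix a x) := hgc.comp hcW
    rw [← hmp.map_eq, integral_map hmp.measurable.aemeasurable hgW.aestronglyMeasurable]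
    simp [Ψ, interpMatrix]
  have h1 : Ψ (Real.pi / 2) = ∫ x, g (goeMatrix σ x) ∂(stdGaussianPi _) := by
    have hmp := measurePreserving_inr (α := Fin n × Fin d) (β := Fin n × Fin n)
    have hgG : Continuous fun x => g (goeMatrix σ x) := hgc.comp hcG
    rw [← hmp.map_eq, integral_map hmp.measurable.aemeasurable hgG.aestronglyMeasurable]
    simp [Ψ, interpMatrix]
  rw [← h0, ← h1, abs_sub_comm]
  refine hmv.trans (le_of_eq ?_)
  ring

/-- The Gaussian approximation of `chaosMatrix`, for Lipschitz test functions. -/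
theorem abs_integral_chaos_sub_goe_le {g : HSMatrix n → ℝ} {L : ℝ≥0} {M : ℝ}
    (hM : ∀ A, |g A| ≤ M) (hg : LipschitzWith L g) {a : Fin d → ℝ} {σ : ℝ} (hσ : 0 < σ)
    (hσa : σ ^ 2 = ∑ k, a k ^ 2) :
    |∫ x, g (chaosMatrix a x) ∂(stdGaussianPi _) - ∫ z, g (goeMatrix σ z) ∂(stdGaussianPi _)|
      ≤ Real.pi * L / σ * √(n ^ 3 * ∑ k, a k ^ 4) := by
  refine le_of_forall_pos_le_add fun ε hε => ?_
  -- Each of the two integrals changes by at most `ε / 2`, and the smooth bound involves only the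
  -- preserved constant `L`, so `ε` may tend to `0`.
  obtain ⟨h, D, D2, K, hh, hhD, hD, hD2, hL, hK⟩ := exists_smooth_approx hg (half_pos hε)
  have hhM : ∀ A, |h A| ≤ M + ε / 2 := fun A => by
    have := abs_add_le (g A) (h A - g A)
    rw [add_sub_cancel] at this
    linarith [hh A, hM A]
  have key := abs_integral_chaos_sub_goe_le_of_smooth hhM hhD hD hD2 hL hK hσ hσa
  have hhc : Continuous h := continuous_iff_continuousAt.2 fun A => (hhD A).continuousAt
  have hdiff : ∀ {ι : Type} [Fintype ι] (Φ : (ι → ℝ) → HSMatrix n), Continuous Φ →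
      |∫ x, h (Φ x) ∂(stdGaussianPi ι) - ∫ x, g (Φ x) ∂(stdGaussianPi ι)| ≤ ε / 2 := by
    intro ι _ Φ hΦ
    have i1 : Integrable (fun x => h (Φ x)) (stdGaussianPi ι) :=
      (HasAllMoments.of_bound (hhc.comp hΦ).aestronglyMeasurable fun x => hhM _).integrable
    have i2 : Integrable (fun x => g (Φ x)) (stdGaussianPi ι) :=
      (HasAllMoments.of_bound (hg.continuous.comp hΦ).aestronglyMeasurable fun x => hM _).integrable
    rw [← integral_sub i1 i2, ← Real.norm_eq_abs]
    refine (norm_integral_le_of_norm_le_const (C := ε / 2)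
      (Eventually.of_forall fun x => hh (Φ x))).trans ?_
    simp
  have h1 := abs_le.1 (hdiff _ (continuous_chaosMatrix (n := n) a))
  have h2 := abs_le.1 (hdiff _ (continuous_goeMatrix (n := n) σ))
  have h3 := abs_le.1 key
  rw [abs_le]
  constructor <;> linarith [h1.1, h1.2, h2.1, h2.2, h3.1, h3.2]

end CLT

/-! ### Laws -/

section Laws

theorem integral_and_variance_inner {ι : Type*} [Fintype ι] {Ω : Type*} [MeasurableSpace Ω]
    {P : Measure Ω} {Y : Ω → EuclideanSpace ℝ ι} (hY : HasGaussianLaw Y P)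
    (mY : ∀ p, ∫ ω, Y ω p ∂P = 0) (t : EuclideanSpace ℝ ι) :
    ∫ ω, inner ℝ t (Y ω) ∂P = 0 ∧
      Var[fun ω => inner ℝ t (Y ω); P] = ∑ p, ∑ q, t p * t q * ∫ ω, Y ω p * Y ω q ∂P := by
  have := hY.isProbabilityMeasure
  have hL : ∀ p, MemLp (fun ω => Y ω p) 2 P := fun p =>
    (hY.map_fun (EuclideanSpace.proj (𝕜 := ℝ) p)).memLp_two
  have e : ∀ ω, inner ℝ t (Y ω) = ∑ p, t p * Y ω p := fun ω => by
    simp [PiLp.inner_apply, mul_comm]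
  have h1 : ∫ ω, inner ℝ t (Y ω) ∂P = 0 := by
    simp only [e]
    rw [integral_finsetSum _ fun p _ => ((hL p).integrable (by norm_num)).const_mul _]
    simp [integral_const_mul, mY]
  refine ⟨h1, ?_⟩
  have hm : MemLp (fun ω => inner ℝ t (Y ω)) 2 P := by
    simp only [e]
    exact memLp_finsetSum _ fun p _ => (hL p).const_mul _
  rw [variance_eq_sub hm, h1]
  have e2 : ∀ ω, ((fun ω => inner ℝ t (Y ω)) ^ 2) ω
      = ∑ p, ∑ q, t p * t q * (Y ω p * Y ω q) := fun ω => by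
    simp only [Pi.pow_apply, e, sq, Finset.sum_mul_sum]
    exact Finset.sum_congr rfl fun p _ => Finset.sum_congr rfl fun q _ => by ring
  have hi : ∀ p q, Integrable (fun ω => t p * t q * (Y ω p * Y ω q)) P := fun p q =>
    ((hL p).integrable_mul (hL q)).const_mul _
  simp only [e2]
  rw [integral_finsetSum _ fun p _ => integrable_finsetSum _ fun q _ => hi p q]
  simp only [integral_finsetSum _ fun q _ => hi _ q, integral_const_mul]
  simp

/-- Centered Gaussian vectors with the same second moments have the same law. -/
theorem map_eq_of_hasGaussianLaw {ι : Type*} [Fintype ι] {Ω Ω' : Type*} [MeasurableSpace Ω]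
    [MeasurableSpace Ω'] {P : Measure Ω} {Q : Measure Ω'} {Y : Ω → EuclideanSpace ℝ ι}
    {Z : Ω' → EuclideanSpace ℝ ι} (hY : HasGaussianLaw Y P) (hZ : HasGaussianLaw Z Q)
    (mY : ∀ p, ∫ ω, Y ω p ∂P = 0) (mZ : ∀ p, ∫ ω, Z ω p ∂Q = 0)
    (h : ∀ p q, ∫ ω, Y ω p * Y ω q ∂P = ∫ ω, Z ω p * Z ω q ∂Q) : P.map Y = Q.map Z := by
  have := hY.isGaussian_map
  have := hZ.isGaussian_map
  refine Measure.ext_of_charFun ?_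
  ext t
  rw [hY.charFun_map_eq, hZ.charFun_map_eq, (integral_and_variance_inner hY mY t).1, (integral_and_variance_inner hZ mZ t).1, (integral_and_variance_inner hY mY t).2,
    (integral_and_variance_inner hZ mZ t).2]
  simp only [h]

theorem isGaussian_stdGaussianPi (ι : Type*) [Fintype ι] : IsGaussian (stdGaussianPi ι) := by
  have h : (stdGaussian (EuclideanSpace ℝ ι)).map (EuclideanSpace.equiv ι ℝ) = stdGaussianPi ι := by
    rw [← map_pi_eq_stdGaussian, Measure.map_map (by fun_prop) (by fun_prop)]
    exact Measure.map_id
  rw [← h]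
  exact isGaussian_map (E := EuclideanSpace ℝ ι) (F := ι → ℝ)
    ((EuclideanSpace.equiv ι ℝ).toContinuousLinearMap)

/-- Linear functions of a standard Gaussian vector are Gaussian. -/
theorem hasGaussianLaw_linear {κ ι : Type*} [Fintype κ] [Fintype ι] (A : ι → κ → ℝ) :
    HasGaussianLaw (fun x : κ → ℝ => (WithLp.toLp 2 fun p => ∑ e, A p e * x e :
      EuclideanSpace ℝ ι)) (stdGaussianPi κ) := by
  have h0 : HasGaussianLaw (fun x : κ → ℝ => x) (stdGaussianPi κ) :=
    ⟨by rw [Measure.map_id']; exact isGaussian_stdGaussianPi κ⟩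
  have h1 := h0.map_fun (ContinuousLinearMap.pi fun p : ι => ∑ e, A p e •
    (ContinuousLinearMap.proj e : (κ → ℝ) →L[ℝ] ℝ))
  convert h1.toLp_pi 2 using 3 with x p
  simp

theorem integral_linear {κ : Type*} [Fintype κ] (A : κ → ℝ) :
    ∫ x, ∑ e, A e * x e ∂(stdGaussianPi κ) = 0 := by
  classical
  rw [integral_finsetSum _ fun e _ => ((hasAllMoments_eval e).const_mul _).integrable]
  simp [integral_const_mul, integral_eval_stdGaussianPi]

theorem integral_linear_mul_linear {κ : Type*} [Fintype κ] (A B : κ → ℝ) :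
    ∫ x, (∑ e, A e * x e) * (∑ e, B e * x e) ∂(stdGaussianPi κ) = ∑ e, A e * B e := by
  classical
  have hi : ∀ e f, HasAllMoments (fun x : κ → ℝ => A e * B f * (x e * x f)) (stdGaussianPi κ) :=
    fun e f => ((hasAllMoments_eval e).mul (hasAllMoments_eval f)).const_mul _
  have e1 : ∀ x : κ → ℝ, (∑ e, A e * x e) * (∑ e, B e * x e)
      = ∑ e, ∑ f, A e * B f * (x e * x f) := fun x => by
    rw [Finset.sum_mul_sum]
    exact Finset.sum_congr rfl fun p _ => Finset.sum_congr rfl fun q _ => by ring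
  simp only [e1]
  rw [integral_finsetSum _ fun e _ => (HasAllMoments.sum _ fun f => hi e f).integrable]
  simp only [integral_finsetSum _ fun f _ => (hi _ f).integrable, integral_const_mul,
    integral_eval_mul_eval]
  simp

end Laws

/-! ### The Wishart law in an eigenbasis of the Toeplitz matrix. -/

section WishartLaw

variable {Ω : Type*} [MeasurableSpace Ω] {P : Measure Ω} {s : ℤ → ℝ} {X : ℕ → ℕ → Ω → ℝ}

/-- The `d × d` Toeplitz matrix of `s`. -/
def toeplitz (s : ℤ → ℝ) (d : ℕ) : Matrix (Fin d) (Fin d) ℝ :=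
  Matrix.of fun k l => s ((k : ℤ) - (l : ℤ))

/-- The matrix is the covariance of the first `d` entries of a row, so its quadratic form is a mean
square. -/
theorem toeplitz_posSemidef [IsProbabilityMeasure P] (hX : IsRowIndepGaussianArray s X P) (d : ℕ) :
    (toeplitz s d).PosSemidef := by
  have hL : ∀ i j, MemLp (X i j) 2 P := fun i j =>
    (hX.gaussian.hasGaussianLaw_eval (i, j)).memLp_two
  have hT : ∀ k l : Fin d, toeplitz s d k l = ∫ ω, X 0 k ω * X 0 l ω ∂P := fun k l => by
    simp [hX.corr, toeplitz]
  refine Matrix.PosSemidef.of_dotProduct_mulVec_nonneg ?_ fun x => ?_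
  · ext k l
    simp only [Matrix.conjTranspose_apply, hT, star_trivial, mul_comm]
  · have e : star x ⬝ᵥ (toeplitz s d).mulVec x = ∫ ω, (∑ k : Fin d, x k * X 0 k ω) ^ 2 ∂P := by
      have e1 : ∀ ω, (∑ k : Fin d, x k * X 0 k ω) ^ 2
          = ∑ k : Fin d, ∑ l : Fin d, x k * x l * (X 0 k ω * X 0 l ω) := fun ω => by
        rw [sq, Finset.sum_mul_sum]
        exact Finset.sum_congr rfl fun p _ => Finset.sum_congr rfl fun q _ => by ring
      have hi : ∀ k l : Fin d, Integrable (fun ω => x k * x l * (X 0 k ω * X 0 l ω)) P :=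
        fun k l => ((hL _ _).integrable_mul (hL _ _)).const_mul _
      simp only [e1]
      rw [integral_finsetSum _ fun k _ => integrable_finsetSum _ fun l _ => hi k l]
      simp only [integral_finsetSum _ fun l _ => hi _ l, integral_const_mul, ← hT, dotProduct,
        Matrix.mulVec, Finset.mul_sum, Pi.star_apply, star_trivial]
      exact Finset.sum_congr rfl fun p _ => Finset.sum_congr rfl fun q _ => by ring
    rw [e]
    positivity

theorem hasGaussianLaw_dataMatrix (hX : IsRowIndepGaussianArray s X P) (n d : ℕ) :
    HasGaussianLaw (fun ω => (WithLp.toLp 2 fun p : Fin n × Fin d => X p.1 p.2 ω :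
      EuclideanSpace ℝ (Fin n × Fin d))) P := by
  let I : Finset (ℕ × ℕ) := Finset.range n ×ˢ Finset.range d
  have h1 := (hX.gaussian.hasGaussianLaw I).map_fun (ContinuousLinearMap.pi
    fun p : Fin n × Fin d => (ContinuousLinearMap.proj (⟨(p.1, p.2), by simp [I]⟩ : I) :
      (I → ℝ) →L[ℝ] ℝ))
  exact h1.toLp_pi 2

variable {n d : ℕ}

/-- Diagonalization of the correlations within a row: the Wishart law as the law of a sum of
independent rank-one matrices. -/
theorem exists_wishartLaw_eq [IsProbabilityMeasure P] (hX : IsRowIndepGaussianArray s X P)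
    (hs : s 0 = 1) (n d : ℕ) :
    ∃ a : Fin d → ℝ, wishartLaw X P n d = (stdGaussianPi (Fin n × Fin d)).map (chaosMatrix a) ∧
      d * ∑ k, a k ^ 2 = (toeplitz s d ^ 2).trace ∧
      d ^ 2 * ∑ k, a k ^ 4 = (toeplitz s d ^ 4).trace := by
  have hT := toeplitz_posSemidef hX d
  set lam := hT.1.eigenvalues with hlam
  set U : Matrix (Fin d) (Fin d) ℝ := hT.1.eigenvectorUnitary.1 with hU
  have hl0 : ∀ k, 0 ≤ lam k := hT.eigenvalues_nonneg
  have hUU : U.transpose * U = 1 := by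
    have := Unitary.coe_star_mul_self hT.1.eigenvectorUnitary
    simpa [Matrix.star_eq_conjTranspose] using this
  have hTU : toeplitz s d = U * Matrix.diagonal lam * U.transpose := by
    conv_lhs => rw [hT.1.spectral_theorem, Unitary.conjStarAlgAut_apply]
    simp [Matrix.star_eq_conjTranspose, hU, hlam]
  have hpow : ∀ m : ℕ, (toeplitz s d ^ m).trace = ∑ k, lam k ^ m := by
    intro m
    have h1 : ∀ m : ℕ, toeplitz s d ^ m * U = U * Matrix.diagonal (fun k => lam k ^ m) := by
      intro m
      induction m with
      | zero => simp
      | succ m ih =>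
        rw [pow_succ, Matrix.mul_assoc]
        nth_rewrite 2 [hTU]
        rw [Matrix.mul_assoc _ U.transpose, hUU, Matrix.mul_one, ← Matrix.mul_assoc, ih,
          Matrix.mul_assoc, Matrix.diagonal_mul_diagonal]
        simp only [pow_succ]
    have h2 : U * U.transpose = 1 := mul_eq_one_comm.1 hUU
    rw [← Matrix.mul_one (toeplitz s d ^ m), ← h2, ← Matrix.mul_assoc, h1, Matrix.trace_mul_comm,
      ← Matrix.mul_assoc, hUU, Matrix.one_mul, Matrix.trace_diagonal]
  -- The unit diagonal fixes the trace. This turns the centring `√d • 1` of the Wishart matrix into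
  -- the centring `∑ a k • 1` of `chaosMatrix`.
  have hsum : ∑ k, lam k = d := by
    have := hpow 1
    simp only [pow_one] at this
    rw [← this]
    simp [Matrix.trace, toeplitz, hs]
  have hd : (√(d : ℝ)) ^ 2 = d := Real.sq_sqrt (by positivity)
  have hd4 : (√(d : ℝ)) ^ 4 = d ^ 2 := by
    rw [show (4 : ℕ) = 2 * 2 from rfl, pow_mul, hd]
  refine ⟨fun k => lam k / √(d : ℝ), ?_, ?_, ?_⟩
  -- Each row is modelled as `U √lam` applied to a standard Gaussian row, with covariance `U
  -- diag(lam) Uᵀ`. In inner products of rows the orthogonal `U` drops out, leaving the weights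
  -- `lam`.
  · set A : Fin n × Fin d → Fin n × Fin d → ℝ := fun p e =>
      if p.1 = e.1 then U p.2 e.2 * √(lam e.2) else 0
    have hlaw := map_eq_of_hasGaussianLaw (hasGaussianLaw_dataMatrix hX n d)
      (hasGaussianLaw_linear A) (fun p => hX.centered _ _) (fun p => integral_linear _) fun p q => by
        simp only
        rw [integral_linear_mul_linear, hX.corr, Fintype.sum_prod_type]
        have : s ((p.2 : ℤ) - (q.2 : ℤ)) = ∑ l, U p.2 l * √(lam l) * (U q.2 l * √(lam l)) := by
          have := congrFun (congrFun hTU p.2) q.2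
          simp only [toeplitz, Matrix.of_apply] at this
          rw [this, Matrix.mul_apply]
          refine Finset.sum_congr rfl fun l _ => ?_
          rw [Matrix.mul_diagonal, Matrix.transpose_apply]
          linear_combination - U p.2 l * U q.2 l * Real.sq_sqrt (hl0 l)
        rw [this]
        by_cases h : p.1 = q.1
        · simp [A, h]
        · have h' : (p.1 : ℕ) ≠ q.1 := fun hh => h (Fin.ext hh)
          simp only [A, h', if_false]
          symm
          refine Finset.sum_eq_zero fun i _ => Finset.sum_eq_zero fun l _ => ?_
          by_cases h1 : p.1 = i
          · have : q.1 ≠ i := fun hh => h (h1.trans hh.symm)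
            simp [this]
          · simp [h1]
    set F : EuclideanSpace ℝ (Fin n × Fin d) → HSMatrix n := fun y => WithLp.toLp 2 fun p =>
      √(d : ℝ) * (1 / (d : ℝ) * ∑ k, y (p.1, k) * y (p.2, k) - if p.1 = p.2 then 1 else 0)
    have hF : Continuous F := by
      refine (PiLp.continuous_toLp 2 _).comp (continuous_pi fun p => ?_)
      fun_prop
    have e1 : ∀ ω, toHS (wishart X n d ω)
        = F (WithLp.toLp 2 fun p : Fin n × Fin d => X p.1 p.2 ω) := by
      intro ω
      ext p
      simp [toHS, wishart, F, Matrix.mul_apply, dataMatrix, Matrix.one_apply]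
    have e2 : ∀ x : Fin n × Fin d → ℝ, F (WithLp.toLp 2 fun p => ∑ e, A p e * x e)
        = chaosMatrix (fun k => lam k / √(d : ℝ)) x := by
      intro x
      ext ⟨p, q⟩
      rw [chaosMatrix_apply]
      have hA : ∀ i k, ∑ e, A (i, k) e * x e = ∑ l, U k l * (√(lam l) * x (i, l)) := by
        intro i k
        rw [Fintype.sum_prod_type, Finset.sum_eq_single i]
        · simp [A, mul_assoc]
        · intro j _ hj; simp [A, Ne.symm hj]
        · simp
      have hsum2 : ∑ k, (∑ e, A (p, k) e * x e) * (∑ e, A (q, k) e * x e)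
          = ∑ l, lam l * (x (p, l) * x (q, l)) := by
        simp only [hA]
        have : ∀ u v : Fin d → ℝ, ∑ k, (∑ l, U k l * u l) * (∑ l, U k l * v l) = ∑ l, u l * v l := by
          intro u v
          have : (U.mulVec u) ⬝ᵥ (U.mulVec v) = u ⬝ᵥ v := by
            rw [Matrix.dotProduct_mulVec, ← Matrix.mulVec_transpose, Matrix.mulVec_mulVec, hUU,
              Matrix.one_mulVec]
          exact this
        rw [this]
        exact Finset.sum_congr rfl fun l _ => by
          linear_combination x (p, l) * x (q, l) * Real.sq_sqrt (hl0 l)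
      simp only [F, hsum2, mul_sub, Finset.sum_sub_distrib, ← Finset.sum_mul, ← Finset.sum_div, hsum]
      congr 1
      · rw [← mul_assoc, Finset.mul_sum]
        refine Finset.sum_congr rfl fun l _ => ?_
        rw [mul_one_div, Real.sqrt_div_self', div_mul_eq_mul_div, one_mul, div_mul_eq_mul_div]
      · rw [Real.div_sqrt]
    have m1 := (hasGaussianLaw_dataMatrix hX n d).aemeasurable
    have m2 := (hasGaussianLaw_linear A).aemeasurable
    rw [wishartLaw]
    simp only [e1]
    have := congrArg (Measure.map F) hlaw
    rw [AEMeasurable.map_map_of_aemeasurable hF.measurable.aemeasurable m1,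
      AEMeasurable.map_map_of_aemeasurable hF.measurable.aemeasurable m2] at this
    simpa only [Function.comp_def, e2] using this
  · rw [hpow]
    simp only [div_pow, hd, ← Finset.sum_div]
    rcases Nat.eq_zero_or_pos d with rfl | h
    · simp
    · field_simp
  · rw [hpow]
    simp only [div_pow, hd4, ← Finset.sum_div]
    rcases Nat.eq_zero_or_pos d with rfl | h
    · simp
    · field_simp

end WishartLaw

/-! ### The GOE-type law as a symmetrized standard Gaussian matrix. -/

section GoeLaw

variable {n d : ℕ}

theorem goeMatrix_eq_linear (σ : ℝ) (z : Fin n × Fin n → ℝ) :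
    goeMatrix σ z = WithLp.toLp 2 fun p => ∑ e, (σ / √2 * ((if p = e then 1 else 0)
      + if p.swap = e then 1 else 0)) * z e := by
  ext ⟨p, q⟩
  rw [goeMatrix_apply]
  simp only [mul_assoc, add_mul, mul_add, ite_mul, one_mul, zero_mul, mul_ite, mul_zero,
    Finset.sum_add_distrib, Finset.sum_ite_eq, Finset.mem_univ, if_true, Prod.swap_prod_mk]

theorem hasGaussianLaw_goeMatrix (σ : ℝ) :
    HasGaussianLaw (goeMatrix (n := n) σ) (stdGaussianPi _) := by
  simpa only [← goeMatrix_eq_linear] using hasGaussianLaw_linear (κ := Fin n × Fin n)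
    (ι := Fin n × Fin n) fun p e => σ / √2 * ((if p = e then 1 else 0) +
      if p.swap = e then 1 else 0)

theorem integral_goeMatrix (σ : ℝ) (p : Fin n × Fin n) :
    ∫ z, goeMatrix σ z p ∂(stdGaussianPi _) = 0 := by
  simp only [goeMatrix_eq_linear]
  exact integral_linear _

theorem integral_goeMatrix_mul (σ : ℝ) (p q : Fin n × Fin n) :
    ∫ z, goeMatrix σ z p * goeMatrix σ z q ∂(stdGaussianPi _) =
      σ ^ 2 * ((if p = q then 1 else 0) + if p.swap = q then 1 else 0) := by
  simp only [goeMatrix_eq_linear]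
  rw [integral_linear_mul_linear]
  have h2 : σ / √2 * (σ / √2) = σ ^ 2 / 2 := by
    rw [div_mul_div_comm, Real.mul_self_sqrt (by norm_num), sq]
  have e : ∀ e : Fin n × Fin n, (σ / √2 * ((if p = e then 1 else 0) + if p.swap = e then 1 else 0))
      * (σ / √2 * ((if q = e then 1 else 0) + if q.swap = e then 1 else 0))
      = σ ^ 2 / 2 * (((if p = e then (if q = e then 1 else 0) + (if q.swap = e then 1 else 0) else 0)
      + if p.swap = e then (if q = e then 1 else 0) + (if q.swap = e then 1 else 0) else 0)) := by
    intro e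
    rw [mul_mul_mul_comm, h2]
    congr 1
    split_ifs <;> ring
  simp only [e, ← Finset.mul_sum, Finset.sum_add_distrib, Finset.sum_ite_eq, Finset.mem_univ,
    if_true]
  have i1 : q = p ↔ p = q := eq_comm
  have i2 : q.swap = p ↔ p.swap = q := by
    rw [Prod.swap_eq_iff_eq_swap, eq_comm]
  have i3 : q = p.swap ↔ p.swap = q := eq_comm
  simp only [Prod.swap_inj, i1, i2, i3]
  ring

/-- `goeLaw` is the law of `goeMatrix`. -/
theorem goeLaw_eq (v : ℝ≥0) (n : ℕ) :
    goeLaw v n = (stdGaussianPi (Fin n × Fin n)).map (goeMatrix √(v : ℝ)) := by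
  set w : Fin n × Fin n → ℝ≥0 := fun p => if p.1 = p.2 then 2 * v else v
  have h1 : (Measure.pi fun p : Fin n × Fin n => gaussianReal 0 (w p))
      = (stdGaussianPi (Fin n × Fin n)).map (fun x p => √(w p : ℝ) * x p) := by
    have hg : ∀ p, (gaussianReal 0 1).map (fun x => √(w p : ℝ) * x) = gaussianReal 0 (w p) := by
      intro p
      rw [gaussianReal_map_const_mul]
      congr 1
      · simp
      · ext; simp
    rw [Measure.pi_map_pi (f := fun p x => √(w p : ℝ) * x) (hμ := fun p => by
      rw [hg]; infer_instance) (fun p => by fun_prop)]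
    simp only [hg]
  set m : Fin n × Fin n → Fin n × Fin n := fun p => (min p.1 p.2, max p.1 p.2)
  set A : Fin n × Fin n → Fin n × Fin n → ℝ := fun p e => if m p = e then √(w e : ℝ) else 0
  have h2 : goeLaw v n = (stdGaussianPi (Fin n × Fin n)).map
      (fun x => WithLp.toLp 2 fun p => ∑ e, A p e * x e) := by
    rw [goeLaw, h1, Measure.map_map]
    · congr 1
      ext x p
      simp [toHS, A, m]
    · exact (PiLp.continuous_toLp 2 _).measurable.comp
        (measurable_pi_iff.2 fun p => measurable_pi_apply _)
    · exact measurable_pi_iff.2 fun p => by fun_prop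
  rw [h2]
  refine map_eq_of_hasGaussianLaw (hasGaussianLaw_linear A) (hasGaussianLaw_goeMatrix _)
    (fun p => integral_linear _) (integral_goeMatrix _) fun p q => ?_
  rw [integral_goeMatrix_mul]
  simp only
  rw [integral_linear_mul_linear, Real.sq_sqrt (NNReal.coe_nonneg v)]
  simp only [A, ite_mul, zero_mul, Finset.sum_ite_eq, Finset.mem_univ, if_true, mul_ite, mul_zero,
    Real.mul_self_sqrt (NNReal.coe_nonneg (w _))]
  -- Two positions read the same upper-triangular variable exactly when they are equal or
  -- transposed. On the diagonal both alternatives hold, which matches the doubled variance.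
  have hm : m p = m q ↔ p = q ∨ p.swap = q := by
    obtain ⟨a, b⟩ := p
    obtain ⟨c, e⟩ := q
    simp only [m, Prod.mk.injEq, Prod.swap_prod_mk]
    constructor
    · rintro ⟨h1, h2⟩
      rcases le_total a b with h | h <;> rcases le_total c e with h' | h' <;>
        simp_all
    · rintro (⟨rfl, rfl⟩ | ⟨rfl, rfl⟩) <;> simp [min_comm, max_comm]
  have hw : m p = m q → (w (m q) : ℝ) = if p.1 = p.2 then (2 * v : ℝ) else v := by
    intro h
    rw [← h]
    have : (min p.1 p.2 = max p.1 p.2) ↔ p.1 = p.2 := by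
      rcases le_total p.1 p.2 with h | h <;> simp [h, eq_comm]
    simp only [w, m, this]
    split_ifs <;> simp
  have hw' : (if m p = m q then (w (m q) : ℝ) else 0)
      = if m p = m q then (if p.1 = p.2 then (2 * v : ℝ) else v) else 0 := by
    split_ifs with h <;> simp_all
  rw [hw']
  simp only [hm]
  obtain ⟨a, b⟩ := p
  by_cases hab : a = b
  · subst hab
    simp only [Prod.swap_prod_mk, or_self, if_true]
    split_ifs <;> ring
  · simp only [hab, if_false]
    by_cases hpq : (a, b) = q
    · subst hpq
      simp [Ne.symm hab]
    · simp [hpq]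

end GoeLaw

/-! ### Identification of the Gaussian counterpart. -/

section Counterpart

variable {Ω : Type*} [MeasurableSpace Ω] {P : Measure Ω} {s : ℤ → ℝ} {X : ℕ → ℕ → Ω → ℝ} {n d : ℕ}

theorem hasAllMoments_chaosMatrix_apply (a : Fin d → ℝ) (p : Fin n × Fin n) :
    HasAllMoments (fun x => chaosMatrix a x p) (stdGaussianPi _) := by
  obtain ⟨i, j⟩ := p
  simp only [chaosMatrix_apply]
  exact HasAllMoments.sum _ fun k =>
    (((hasAllMoments_eval _).mul (hasAllMoments_eval _)).sub (.const _)).const_mul _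

theorem integral_chaosMatrix (a : Fin d → ℝ) (p : Fin n × Fin n) :
    ∫ x, chaosMatrix a x p ∂(stdGaussianPi _) = 0 := by
  obtain ⟨i, j⟩ := p
  have hp := fun k : Fin d => (hasAllMoments_eval (i, k)).mul (hasAllMoments_eval (j, k))
  simp only [chaosMatrix_apply]
  rw [integral_finsetSum _ fun k _ => (((hp k).sub (.const _)).const_mul _).integrable]
  refine Finset.sum_eq_zero fun k _ => ?_
  rw [integral_const_mul, integral_sub (hp k).integrable (HasAllMoments.const _).integrable,
    integral_eval_mul_eval]
  simp

/-- Independence of the columns leaves only `k = l`. The outcome is the covariance of `goeMatrix σ`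
with `σ² = ∑ a k ^ 2`. -/
theorem integral_chaosMatrix_mul (a : Fin d → ℝ) (p q : Fin n × Fin n) :
    ∫ x, chaosMatrix a x p * chaosMatrix a x q ∂(stdGaussianPi _) =
      (∑ k, a k ^ 2) * ((if p = q then 1 else 0) + if p.swap = q then 1 else 0) := by
  obtain ⟨i, j⟩ := p
  obtain ⟨i', j'⟩ := q
  have e1 : ∀ x : Fin n × Fin d → ℝ, chaosMatrix a x (i, j) * chaosMatrix a x (i', j')
      = ∑ k, ∑ l, a k * a l * ((x (i, k) * x (j, k) - if i = j then 1 else 0)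
        * (x (i', l) * x (j', l) - if i' = j' then 1 else 0)) := fun x => by
    rw [chaosMatrix_apply, chaosMatrix_apply, Finset.sum_mul_sum]
    exact Finset.sum_congr rfl fun p _ => Finset.sum_congr rfl fun q _ => by ring
  have hp : ∀ (i j : Fin n) (k : Fin d), HasAllMoments (fun x : Fin n × Fin d → ℝ =>
      x (i, k) * x (j, k) - if i = j then 1 else 0) (stdGaussianPi _) := fun i j k =>
    ((hasAllMoments_eval _).mul (hasAllMoments_eval _)).sub (.const _)
  have hi := fun k l => ((hp i j k).mul (hp i' j' l)).const_mul (a k * a l)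
  simp only [e1]
  rw [integral_finsetSum _ fun k _ => (HasAllMoments.sum _ fun l => hi k l).integrable,
    Finset.sum_mul]
  refine Finset.sum_congr rfl fun k _ => ?_
  rw [integral_finsetSum _ fun l _ => (hi k l).integrable]
  have hc := fun l => integral_mul_column (e := (id : Fin n × Fin d → _)) Function.injective_id
    i j i' j' k l
  simp only [id] at hc
  simp only [integral_const_mul, hc, mul_ite, mul_zero, Finset.sum_ite_eq, Finset.mem_univ, if_true,
    Prod.mk.injEq, Prod.swap_prod_mk, ← ite_and, mul_one, and_comm, sq]

theorem gaussianCounterpartLaw_eq [IsProbabilityMeasure P] (hX : IsRowIndepGaussianArray s X P)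
    {a : Fin d → ℝ} (ha : wishartLaw X P n d = (stdGaussianPi (Fin n × Fin d)).map (chaosMatrix a)) :
    gaussianCounterpartLaw X P n d
      = (stdGaussianPi (Fin n × Fin n)).map (goeMatrix √(∑ k, a k ^ 2)) := by
  have hcm : Measurable (chaosMatrix (n := n) a) := (continuous_chaosMatrix a).measurable
  -- The image measure under a map that is not a.e. measurable is `0` by convention, whereas this
  -- law is a probability measure.
  have hae : AEMeasurable (fun ω => toHS (wishart X n d ω)) P := by
    refine AEMeasurable.of_map_ne_zero ?_
    change wishartLaw X P n d ≠ 0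
    rw [ha]
    have := Measure.isProbabilityMeasure_map (μ := stdGaussianPi (Fin n × Fin d)) hcm.aemeasurable
    exact IsProbabilityMeasure.ne_zero _
  have hm : ∀ p : Fin n × Fin n, Measurable fun A : HSMatrix n => A p := fun p => by fun_prop
  have hcov : ∀ p q, wishartCov X P n d p q
      = (∑ k, a k ^ 2) * ((if p = q then 1 else 0) + if p.swap = q then 1 else 0) := by
    intro p q
    have h1 : wishartCov X P n d p q = cov[fun A => A p, fun A => A q; wishartLaw X P n d] := by
      rw [wishartLaw, covariance_map (hm p).aestronglyMeasurable (hm q).aestronglyMeasurable hae]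
      rfl
    rw [h1, ha, covariance_map (hm p).aestronglyMeasurable (hm q).aestronglyMeasurable
      hcm.aemeasurable]
    simp only [Function.comp_def]
    rw [covariance_eq_sub (hasAllMoments_chaosMatrix_apply a p).memLp_two
      (hasAllMoments_chaosMatrix_apply a q).memLp_two]
    simp only [Pi.mul_apply, integral_chaosMatrix, integral_chaosMatrix_mul]
    ring
  have hpsd := wishartCov_posSemidef hX n d
  have hG : HasGaussianLaw (fun A : HSMatrix n => A)
      (multivariateGaussian 0 (wishartCov X P n d)) := IsGaussian.hasGaussianLaw_id
  have hmean : ∀ p, ∫ A : HSMatrix n, A p ∂(multivariateGaussian 0 (wishartCov X P n d)) = 0 := by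
    intro p
    have := ContinuousLinearMap.integral_comp_comm (EuclideanSpace.proj (𝕜 := ℝ) p)
      hG.integrable
    simpa using this
  have hmem : ∀ p, MemLp (fun A : HSMatrix n => A p) 2
      (multivariateGaussian 0 (wishartCov X P n d)) := fun p =>
    (hG.map_fun (EuclideanSpace.proj (𝕜 := ℝ) p)).memLp_two
  have key := map_eq_of_hasGaussianLaw hG (hasGaussianLaw_goeMatrix √(∑ k, a k ^ 2)) hmean
    (integral_goeMatrix _) fun p q => by
      have h1 := covariance_eval_multivariateGaussian (μ := 0) hpsd p q
      rw [covariance_eq_sub (hmem p) (hmem q), hmean, zero_mul, sub_zero, hcov] at h1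
      rw [integral_goeMatrix_mul, Real.sq_sqrt (by positivity)]
      exact h1
  rw [Measure.map_id'] at key
  exact key

end Counterpart

/-! ### Bounds for the Fortet-Mourier distances in terms of traces. -/

section FortetMourier

/-- The uniform bound makes the set bounded above, so that `sSup` is a genuine supremum; the test
function `0` gives nonnegativity. -/
theorem fortetMourierDist_mem_Icc {E : Type*} [PseudoMetricSpace E] [MeasurableSpace E]
    {μ ν : Measure E} {C : ℝ} (h : ∀ (g : E → ℝ) (M L : ℝ≥0), L ≤ 1 → (∀ x, |g x| ≤ M) →
      LipschitzWith L g → ∫ x, g x ∂μ - ∫ x, g x ∂ν ≤ C) :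
    0 ≤ fortetMourierDist μ ν ∧ fortetMourierDist μ ν ≤ C := by
  have hmem : (0 : ℝ) ∈ {r : ℝ | ∃ (g : E → ℝ) (M L : ℝ≥0), M + L ≤ 1 ∧ (∀ x, |g x| ≤ M) ∧
      LipschitzWith L g ∧ r = ∫ x, g x ∂μ - ∫ x, g x ∂ν} :=
    ⟨fun _ => 0, 0, 0, by simp, by simp, LipschitzWith.const 0, by simp⟩
  have hle : ∀ r ∈ {r : ℝ | ∃ (g : E → ℝ) (M L : ℝ≥0), M + L ≤ 1 ∧ (∀ x, |g x| ≤ M) ∧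
      LipschitzWith L g ∧ r = ∫ x, g x ∂μ - ∫ x, g x ∂ν}, r ≤ C := by
    rintro r ⟨g, M, L, hML, hM, hL, rfl⟩
    exact h g M L (le_trans le_add_self hML) hM hL
  exact ⟨le_csSup ⟨C, hle⟩ hmem, csSup_le ⟨0, hmem⟩ hle⟩

/-- A criterion for `PhiClose`. -/
theorem phiClose_of_le {φ : ℕ → ℕ → ℝ≥0∞} {μ ν : (n d : ℕ) → Measure (HSMatrix n)} {r : ℝ → ℝ}
    (hr : Tendsto r (𝓝 0) (𝓝 0)) {d₀ : ℕ}
    (h : ∀ n d, 1 ≤ n → d₀ ≤ d → 0 ≤ fortetMourierDist (μ n d) (ν n d) ∧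
      fortetMourierDist (μ n d) (ν n d) ≤ r (φ n d).toReal) : PhiClose φ μ ν := by
  have hφ : Tendsto (fun p : ℕ × ℕ => (φ p.1 p.2).toReal)
      ((atTop ×ˢ atTop) ⊓ comap (fun p : ℕ × ℕ => φ p.1 p.2) (𝓝 0)) (𝓝 0) :=
    ((ENNReal.tendsto_toReal ENNReal.zero_ne_top).comp tendsto_comap).mono_left inf_le_right
  have hev : ∀ᶠ p : ℕ × ℕ in (atTop ×ˢ atTop) ⊓ comap (fun p : ℕ × ℕ => φ p.1 p.2) (𝓝 0),
      1 ≤ p.1 ∧ d₀ ≤ p.2 :=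
    ((eventually_ge_atTop 1).prod_mk (eventually_ge_atTop d₀)).filter_mono inf_le_left
  refine squeeze_zero' ?_ ?_ (hr.comp hφ)
  · filter_upwards [hev] with p hp using (h p.1 p.2 hp.1 hp.2).1
  · filter_upwards [hev] with p hp using (h p.1 p.2 hp.1 hp.2).2

variable {Ω : Type*} [MeasurableSpace Ω] {P : Measure Ω} {s : ℤ → ℝ} {X : ℕ → ℕ → Ω → ℝ}

theorem integral_map_continuous {κ : Type*} [Fintype κ] {n : ℕ} {Φ : (κ → ℝ) → HSMatrix n}
    (hΦ : Continuous Φ) {g : HSMatrix n → ℝ} (hg : Continuous g) :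
    ∫ A, g A ∂((stdGaussianPi κ).map Φ) = ∫ x, g (Φ x) ∂(stdGaussianPi κ) :=
  integral_map hΦ.measurable.aemeasurable hg.aestronglyMeasurable

/-- The distance between the normalized Wishart matrix and its Gaussian counterpart. -/
theorem fortetMourierDist_wishartLaw [IsProbabilityMeasure P] (hX : IsRowIndepGaussianArray s X P)
    (hs : s 0 = 1) (n : ℕ) {d : ℕ} (hd : 1 ≤ d) (hS : 0 < (toeplitz s d ^ 2).trace) :
    0 ≤ fortetMourierDist (wishartLaw X P n d) (gaussianCounterpartLaw X P n d) ∧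
      fortetMourierDist (wishartLaw X P n d) (gaussianCounterpartLaw X P n d) ≤
        Real.pi * √(n ^ 3 * ((toeplitz s d ^ 4).trace / d ^ 2) / ((toeplitz s d ^ 2).trace / d)) := by
  obtain ⟨a, ha, h2, h4⟩ := exists_wishartLaw_eq hX hs n d
  have hd0 : (d : ℝ) ≠ 0 := by positivity
  rw [← h2] at hS ⊢
  rw [← h4, mul_div_cancel_left₀ _ hd0, mul_div_cancel_left₀ _ (pow_ne_zero 2 hd0),
    gaussianCounterpartLaw_eq hX ha, ha]
  have hS' : 0 < ∑ k, a k ^ 2 := pos_of_mul_pos_right hS (by positivity)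
  refine fortetMourierDist_mem_Icc fun g M L hL hM hg => ?_
  rw [integral_map_continuous (continuous_chaosMatrix a) hg.continuous,
    integral_map_continuous (continuous_goeMatrix _) hg.continuous]
  refine (le_abs_self _).trans ((abs_integral_chaos_sub_goe_le hM hg (Real.sqrt_pos.2 hS')
    (Real.sq_sqrt hS'.le)).trans ?_)
  rw [Real.sqrt_div' _ hS'.le, div_mul_eq_mul_div, mul_div_assoc]
  have hL' : (L : ℝ) ≤ 1 := hL
  gcongr
  exact mul_le_of_le_one_right Real.pi_pos.le hL'

/-- Couple both matrices through the same `z`: their difference is `goeMatrix (σ - τ) z`, and the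
mean Frobenius norm of `z` is at most `n`. The factor `1 / √2` is discarded. -/
theorem abs_integral_goe_sub_goe_le {n : ℕ} {g : HSMatrix n → ℝ} {M : ℝ} {L : ℝ≥0} (hL : L ≤ 1)
    (hM : ∀ A, |g A| ≤ M) (hg : LipschitzWith L g) (σ τ : ℝ) :
    |∫ z, g (goeMatrix σ z) ∂(stdGaussianPi _) - ∫ z, g (goeMatrix τ z) ∂(stdGaussianPi _)|
      ≤ 2 * n * |σ - τ| := by
  have hc : ∀ σ, Continuous fun z => g (goeMatrix σ z) := fun σ =>
    hg.continuous.comp (continuous_goeMatrix σ)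
  have hi : ∀ σ, Integrable (fun z => g (goeMatrix σ z)) (stdGaussianPi _) := fun σ =>
    (HasAllMoments.of_bound (hc σ).aestronglyMeasurable fun z => hM _).integrable
  have hS : HasAllMoments (fun z : Fin n × Fin n → ℝ => ∑ i, ∑ j, z (i, j) ^ 2)
      (stdGaussianPi _) := by
    simp only [sq]
    exact HasAllMoments.sum _ fun i => HasAllMoments.sum _ fun j =>
      (hasAllMoments_eval _).mul (hasAllMoments_eval _)
  obtain ⟨hsi, hle⟩ := integral_sqrt_le hS.integrable fun z => by positivity
  have hn : ∫ z, ∑ i, ∑ j, z (i, j) ^ 2 ∂(stdGaussianPi (Fin n × Fin n)) = n ^ 2 := by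
    have h1 : ∀ i j : Fin n, HasAllMoments (fun z : Fin n × Fin n → ℝ => z (i, j) * z (i, j))
      (stdGaussianPi _) := fun i j => (hasAllMoments_eval _).mul (hasAllMoments_eval _)
    simp only [sq]
    rw [integral_finsetSum _ fun i _ => (HasAllMoments.sum _ fun j => h1 i j).integrable]
    simp only [integral_finsetSum _ fun j _ => (h1 _ j).integrable, integral_eval_mul_eval]
    simp
  rw [hn, Real.sqrt_sq (by positivity)] at hle
  rw [← integral_sub (hi σ) (hi τ), ← Real.norm_eq_abs]
  refine (norm_integral_le_of_norm_le (hsi.const_mul (2 * |σ - τ|))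
    (Eventually.of_forall fun z => ?_)).trans ?_
  · have h1 := hg.norm_sub_le (goeMatrix σ z) (goeMatrix τ z)
    have h2 : goeMatrix σ z - goeMatrix τ z = goeMatrix (σ - τ) z := by
      simp only [goeMatrix, sub_div, sub_smul]
    have h3 := norm_goeMatrix_le (σ - τ) z
    rw [h2] at h1
    have hL' : (L : ℝ) ≤ 1 := hL
    have h4 : |σ - τ| / √2 ≤ |σ - τ| :=
      div_le_self (abs_nonneg _) (Real.one_le_sqrt.2 (by norm_num))
    calc _ ≤ L * ‖goeMatrix (σ - τ) z‖ := h1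
      _ ≤ 1 * (|σ - τ| * (2 * √(∑ i, ∑ j, z (i, j) ^ 2))) := by
        gcongr
        exact h3.trans (by gcongr)
      _ = _ := by ring
  · rw [integral_const_mul]
    calc _ ≤ 2 * |σ - τ| * n := by gcongr
      _ = _ := by ring

/-- The distance between the Gaussian counterpart and a GOE-type matrix. -/
theorem fortetMourierDist_gaussianCounterpartLaw [IsProbabilityMeasure P]
    (hX : IsRowIndepGaussianArray s X P) (hs : s 0 = 1) (n : ℕ) {d : ℕ} (hd : 1 ≤ d) (v : ℝ≥0) :
    0 ≤ fortetMourierDist (gaussianCounterpartLaw X P n d) (goeLaw v n) ∧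
      fortetMourierDist (gaussianCounterpartLaw X P n d) (goeLaw v n) ≤
        2 * n * |√((toeplitz s d ^ 2).trace / d) - √(v : ℝ)| := by
  obtain ⟨a, ha, h2, -⟩ := exists_wishartLaw_eq hX hs n d
  have hd0 : (d : ℝ) ≠ 0 := by positivity
  rw [← h2, mul_div_cancel_left₀ _ hd0, gaussianCounterpartLaw_eq hX ha, goeLaw_eq]
  refine fortetMourierDist_mem_Icc fun g M L hL hM hg => ?_
  rw [integral_map_continuous (continuous_goeMatrix _) hg.continuous,
    integral_map_continuous (continuous_goeMatrix _) hg.continuous]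
  exact (le_abs_self _).trans (abs_integral_goe_sub_goe_le hL hM hg _ _)

theorem gaussianCounterpartLaw_eq_goeLaw [IsProbabilityMeasure P]
    (hX : IsRowIndepGaussianArray s X P) (hs : s 0 = 1) (n : ℕ) {d : ℕ} (hd : 1 ≤ d) {v : ℝ≥0}
    (hv : (toeplitz s d ^ 2).trace / d = v) : gaussianCounterpartLaw X P n d = goeLaw v n := by
  obtain ⟨a, ha, h2, -⟩ := exists_wishartLaw_eq hX hs n d
  have hd0 : (d : ℝ) ≠ 0 := by positivity
  rw [goeLaw_eq, ← hv, ← h2, mul_div_cancel_left₀ _ hd0, gaussianCounterpartLaw_eq hX ha]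

end FortetMourier

/-! ### Traces of powers of Toeplitz matrices -/

section Toeplitz

variable {s : ℤ → ℝ}

/-- Enlarging the matrix by one row and one column adds the diagonal entry and twice the same sum of
squares. After division by `d` this is a Cesàro mean of partial sums of `‖s‖²`. -/
theorem trace_toeplitz_sq (heven : ∀ z, s (-z) = s z) (d : ℕ) :
    (toeplitz s d ^ 2).trace =
      ∑ m ∈ Finset.range d, (s 0 ^ 2 + 2 * ∑ j ∈ Finset.range m, s ((j : ℤ) + 1) ^ 2) := by
  have h1 : (toeplitz s d ^ 2).trace =
      ∑ k ∈ Finset.range d, ∑ l ∈ Finset.range d, s ((k : ℤ) - l) ^ 2 := by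
    rw [sq]
    simp only [Finset.sum_range, Matrix.trace, Matrix.diag_apply, Matrix.mul_apply, toeplitz,
      Matrix.of_apply]
    refine Finset.sum_congr rfl fun k _ => Finset.sum_congr rfl fun l _ => ?_
    rw [← heven ((l : ℤ) - k), neg_sub, sq]
  rw [h1]
  clear h1
  induction d with
  | zero => simp
  | succ d ih =>
    rw [Finset.sum_range_succ (fun m => s 0 ^ 2 + 2 * ∑ j ∈ Finset.range m, s ((j : ℤ) + 1) ^ 2),
      ← ih]
    simp only [Finset.sum_range_succ _ d, Finset.sum_add_distrib, sub_self]
    have e1 : ∑ k ∈ Finset.range d, s ((k : ℤ) - d) ^ 2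
        = ∑ j ∈ Finset.range d, s ((j : ℤ) + 1) ^ 2 := by
      rw [← Finset.sum_range_reflect]
      refine Finset.sum_congr rfl fun j hj => ?_
      have := Finset.mem_range.1 hj
      rw [← heven]
      congr 2
      omega
    have e2 : ∑ k ∈ Finset.range d, s ((d : ℤ) - k) ^ 2
        = ∑ j ∈ Finset.range d, s ((j : ℤ) + 1) ^ 2 := by
      rw [← e1]
      refine Finset.sum_congr rfl fun j hj => ?_
      rw [← heven, neg_sub]
    rw [e1, e2]
    ring

theorem sum_natAbs_sub_le {f : ℕ → ℝ} (hf : ∀ j, 0 ≤ f j) {d : ℕ} (k : Fin d) :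
    ∑ l : Fin d, f ((k : ℤ) - (l : ℤ)).natAbs ≤ 2 * ∑ j ∈ Finset.range d, f j := by
  obtain ⟨k, hk⟩ := k
  rw [← Finset.sum_range (fun l => f ((k : ℤ) - (l : ℤ)).natAbs),
    -- Split the row at the diagonal. The entries `l ≤ k` have distances `0, …, k` and those with `l
    -- > k` have distances from `1` on, so each half is at most the full sum.
    ← Finset.sum_range_add_sum_Ico _ (Nat.succ_le_of_lt hk), two_mul]
  refine add_le_add ?_ ?_
  · rw [← Finset.sum_range_reflect]
    refine le_trans (le_of_eq (Finset.sum_congr rfl fun j hj => ?_))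
      (Finset.sum_le_sum_of_subset_of_nonneg (Finset.range_subset_range.2 hk) fun j _ _ => hf j)
    have := Finset.mem_range.1 hj
    congr 1
    omega
  · rw [Finset.sum_Ico_eq_sum_range]
    calc _ ≤ ∑ j ∈ Finset.range (d - (k + 1)), f (j + 1) :=
          le_of_eq (Finset.sum_congr rfl fun j hj => by congr 1; omega)
      _ ≤ ∑ j ∈ Finset.range (d - (k + 1) + 1), f j := by
          rw [Finset.sum_range_succ']; linarith [hf 0]
      _ ≤ _ := Finset.sum_le_sum_of_subset_of_nonneg
          (Finset.range_subset_range.2 (by omega)) fun j _ _ => hf j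

theorem sum_rotate {ι : Type*} [Fintype ι] (F : ι → ι → ι → ι → ℝ) :
    ∑ k, ∑ l, ∑ p, ∑ q, F l p q k = ∑ k, ∑ l, ∑ p, ∑ q, F k l p q := by
  rw [Finset.sum_comm]
  refine Finset.sum_congr rfl fun l _ => ?_
  rw [Finset.sum_comm]
  refine Finset.sum_congr rfl fun p _ => ?_
  rw [Finset.sum_comm]

/-- AM-GM for the four products of three of the fourth powers, carried out as two pairings followed
by a third. -/
theorem mul_pow_three_le (a b c e : ℝ) :
    a ^ 3 * b ^ 3 * c ^ 3 * e ^ 3 ≤ (a ^ 4 * b ^ 4 * c ^ 4 + b ^ 4 * c ^ 4 * e ^ 4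
      + c ^ 4 * e ^ 4 * a ^ 4 + e ^ 4 * a ^ 4 * b ^ 4) / 4 := by
  nlinarith [sq_nonneg (a ^ 2 * b ^ 2 * c ^ 2 - b ^ 2 * c ^ 2 * e ^ 2),
    sq_nonneg (c ^ 2 * e ^ 2 * a ^ 2 - e ^ 2 * a ^ 2 * b ^ 2),
    sq_nonneg ((a * b * c) * (b * c * e) - (c * e * a) * (e * a * b))]

/-- A Young-type inequality for the fourth power of a Toeplitz matrix. -/
theorem trace_toeplitz_pow_four_le {w : ℕ → ℝ} (hw : ∀ z : ℤ, |s z| ≤ w z.natAbs ^ 3)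
    (d : ℕ) :
    (toeplitz s d ^ 4).trace ≤ d * (2 * ∑ j ∈ Finset.range d, w j ^ 4) ^ 3 := by
  set u : Fin d → Fin d → ℝ := fun k l => w ((k : ℤ) - (l : ℤ)).natAbs
  set S := 2 * ∑ j ∈ Finset.range d, w j ^ 4
  have hS : 0 ≤ S := by positivity
  have hrow : ∀ k, ∑ l, u k l ^ 4 ≤ S := fun k =>
    sum_natAbs_sub_le (f := fun j => w j ^ 4) (fun j => by positivity) k
  -- Omitting one edge opens the cycle `k, l, p, q` into a path: its sums over `q`, `p`, `l` are
  -- bounded in turn by `S`, and `k` is free.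
  have hpath : ∑ k, ∑ l, ∑ p, ∑ q, u k l ^ 4 * u l p ^ 4 * u p q ^ 4 ≤ d * S ^ 3 := by
    simp only [← Finset.mul_sum, mul_assoc]
    have h1 : ∀ l, ∑ p, u l p ^ 4 * ∑ q, u p q ^ 4 ≤ S * S := fun l => by
      calc _ ≤ ∑ p, u l p ^ 4 * S := by gcongr; exact hrow _
        _ ≤ _ := by rw [← Finset.sum_mul]; gcongr; exact hrow _
    have h2 : ∀ k, ∑ l, u k l ^ 4 * ∑ p, u l p ^ 4 * ∑ q, u p q ^ 4 ≤ S * (S * S) := fun k => by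
      calc _ ≤ ∑ l, u k l ^ 4 * (S * S) := by gcongr; exact h1 _
        _ ≤ _ := by rw [← Finset.sum_mul]; gcongr; exact hrow _
    refine (Finset.sum_le_sum fun k _ => h2 k).trans (le_of_eq ?_)
    rw [Finset.sum_const, Finset.card_univ, Fintype.card_fin, nsmul_eq_mul]
    ring
  have htr : (toeplitz s d ^ 4).trace = ∑ k, ∑ l, ∑ p, ∑ q, toeplitz s d k l * toeplitz s d l p
      * toeplitz s d p q * toeplitz s d q k := by
    have : toeplitz s d ^ 4 = toeplitz s d * (toeplitz s d * (toeplitz s d * toeplitz s d)) := by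
      noncomm_ring
    rw [this]
    simp only [Matrix.trace, Matrix.diag_apply, Matrix.mul_apply, Finset.mul_sum, mul_assoc]
  have hT : ∀ k l, |toeplitz s d k l| ≤ u k l ^ 3 := fun k l => hw _
  set F : Fin d → Fin d → Fin d → Fin d → ℝ := fun k l p q =>
    u k l ^ 4 * u l p ^ 4 * u p q ^ 4 with hF
  -- With `|s| ≤ w ^ 3`, AM-GM bounds the cyclic product by the mean of four path products, one for
  -- each omitted edge. Cyclic relabelling gives them equal sums.
  have hle : ∀ k l p q, toeplitz s d k l * toeplitz s d l p * toeplitz s d p q * toeplitz s d q k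
      ≤ (F k l p q + F l p q k + F p q k l + F q k l p) / 4 := by
    intro k l p q
    refine (le_abs_self _).trans ?_
    rw [abs_mul, abs_mul, abs_mul]
    refine le_trans ?_ (mul_pow_three_le (u k l) (u l p) (u p q) (u q k))
    have := fun k l => (abs_nonneg _).trans (hT k l)
    exact mul_le_mul (mul_le_mul (mul_le_mul (hT _ _) (hT _ _) (abs_nonneg _) (this _ _))
      (hT _ _) (abs_nonneg _) (mul_nonneg (this _ _) (this _ _))) (hT _ _) (abs_nonneg _)
      (mul_nonneg (mul_nonneg (this _ _) (this _ _)) (this _ _))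
  rw [htr]
  refine (Finset.sum_le_sum fun k _ => Finset.sum_le_sum fun l _ => Finset.sum_le_sum fun p _ =>
    Finset.sum_le_sum fun q _ => hle k l p q).trans ?_
  simp only [← Finset.sum_div, Finset.sum_add_distrib]
  have r1 := sum_rotate F
  have r2 := (sum_rotate fun k l p q => F l p q k).trans r1
  have r3 := (sum_rotate fun k l p q => F p q k l).trans r2
  rw [r1, r2, r3]
  linarith

end Toeplitz

/-! ### Power sums -/

section PowerSums

/-- Bernoulli's inequality `(1 - 1 / y) ^ q ≤ 1 - q / y` gives `y ^ (q - 1) ≤ (y ^ q - (y - 1) ^ q)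
/ q`, which telescopes. -/
theorem sum_rpow_le_of_pos {q : ℝ} (h0 : 0 < q) (h1 : q ≤ 1) (N : ℕ) :
    ∑ j ∈ Finset.range N, ((j : ℝ) + 1) ^ (q - 1) ≤ (N : ℝ) ^ q / q := by
  induction N with
  | zero => simp [h0.ne']
  | succ N ih =>
    rw [Finset.sum_range_succ]
    refine (add_le_add_left ih _).trans ?_
    have hy : (0 : ℝ) < N + 1 := by positivity
    have hb := rpow_one_add_le_one_add_mul_self (s := -1 / ((N : ℝ) + 1))
      (by rw [neg_div, neg_le_neg_iff, div_le_one hy]; linarith [N.cast_nonneg (α := ℝ)]) h0.le h1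
    have e : (1 + -1 / ((N : ℝ) + 1)) = N / (N + 1) := by field_simp; ring
    rw [e, Real.div_rpow (by positivity) hy.le, div_le_iff₀ (by positivity)] at hb
    have e2 : (1 + q * (-1 / ((N : ℝ) + 1))) * ((N : ℝ) + 1) ^ q
        = ((N : ℝ) + 1) ^ q - q * ((N : ℝ) + 1) ^ (q - 1) := by
      rw [Real.rpow_sub_one hy.ne']; field_simp; ring
    rw [e2] at hb
    push_cast
    rw [div_add' _ _ _ h0.ne', div_le_div_iff_of_pos_right h0]
    linarith

/-- Again a telescoping comparison, uniform in `N`. It controls tails through the offset `m`, and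
whole convergent sums with `m = 0`. -/
theorem sum_rpow_le_of_neg {q : ℝ} (h0 : q < 0) (m N : ℕ) :
    ∑ i ∈ Finset.range N, ((i : ℝ) + m + 1) ^ (q - 1) ≤ (1 + 1 / -q) * ((m : ℝ) + 1) ^ q := by
  have hq : 0 < -q := by linarith
  -- The first term is estimated separately by `(m + 1) ^ q`, and telescoping starts at the second.
  -- The empty sum is set apart because the formula can fail at `N = 0`.
  suffices h : ∑ i ∈ Finset.range N, ((i : ℝ) + m + 1) ^ (q - 1) ≤
      (m + 1 : ℝ) ^ q + ((m + 1 : ℝ) ^ q - ((N : ℝ) + m) ^ q) / -q ∨ N = 0 by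
    have hm : (0 : ℝ) < m + 1 := by positivity
    have hp : 0 < ((m : ℝ) + 1) ^ q := by positivity
    rcases h with h | rfl
    · refine h.trans ?_
      have : 0 ≤ ((N : ℝ) + m) ^ q := by positivity
      rw [add_mul, one_mul, div_mul_eq_mul_div, one_mul]
      gcongr
      linarith
    · simp only [Finset.range_zero, Finset.sum_empty]
      positivity
  induction N with
  | zero => simp
  | succ N ih =>
    left
    rw [Finset.sum_range_succ]
    rcases Nat.eq_zero_or_pos N with rfl | hN
    · simp only [Finset.range_zero, Finset.sum_empty, Nat.cast_zero, zero_add, Nat.cast_one,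
        add_comm (1 : ℝ) m, sub_self, zero_div, add_zero]
      exact Real.rpow_le_rpow_of_exponent_le (by linarith [m.cast_nonneg (α := ℝ)]) (by linarith)
    · have ih := ih.resolve_right hN.ne'
      have hN' : (1 : ℝ) ≤ N := by exact_mod_cast hN
      set y : ℝ := N + m + 1 with hy
      have hm := m.cast_nonneg (α := ℝ)
      have hy1 : 0 < y - 1 := by rw [hy]; linarith
      have hy0 : 0 < y := by linarith
      have e0 : (N : ℝ) + m = y - 1 := by rw [hy]; ring
      rw [e0] at ih
      have hb : 1 - q / y ≤ ((y - 1) / y) ^ q := by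
        rw [Real.rpow_def_of_pos (by positivity)]
        have h1 : Real.log ((y - 1) / y) ≤ (y - 1) / y - 1 :=
          Real.log_le_sub_one_of_pos (by positivity)
        have h2 : (y - 1) / y - 1 = -1 / y := by field_simp; ring
        have h3 : -q / y ≤ Real.log ((y - 1) / y) * q := by
          rw [h2] at h1
          calc -q / y = -1 / y * q := by ring
            _ ≤ _ := mul_le_mul_of_nonpos_right h1 h0.le
        have := Real.add_one_le_exp (Real.log ((y - 1) / y) * q)
        calc 1 - q / y = -q / y + 1 := by ring
          _ ≤ _ := by linarith
      rw [Real.div_rpow hy1.le hy0.le, le_div_iff₀ (by positivity)] at hb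
      have e2 : (1 - q / y) * y ^ q = y ^ q - q * y ^ (q - 1) := by
        rw [Real.rpow_sub_one hy0.ne']; field_simp
      rw [e2] at hb
      have e3 : ((N + 1 : ℕ) : ℝ) + m = y := by rw [hy]; push_cast; ring
      rw [e3]
      have h5 : y ^ (q - 1) ≤ ((y - 1) ^ q - y ^ q) / -q := by
        rw [le_div_iff₀ hq]; linarith
      calc _ ≤ _ := add_le_add ih h5
        _ = _ := by ring

theorem sum_inv_le (N : ℕ) : ∑ j ∈ Finset.range N, ((j : ℝ) + 1)⁻¹ ≤ 1 + Real.log N := by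
  have := harmonic_le_one_add_log N
  simpa [harmonic] using this

theorem log_le_sum_inv (N : ℕ) :
    Real.log ((N : ℝ) + 1) ≤ ∑ j ∈ Finset.range N, ((j : ℝ) + 1)⁻¹ := by
  have := log_add_one_le_harmonic N
  simpa [harmonic] using this

end PowerSums

/-! ### The correlation function of fractional Gaussian noise -/

section FracCorr

theorem fracCorr_neg (H : ℝ) (z : ℤ) : fracCorr H (-z) = fracCorr H z := by
  unfold fracCorr
  have h1 : |((-z : ℤ) : ℝ) + 1| = |(z : ℝ) - 1| := by
    rw [← abs_neg]; congr 1; push_cast; ring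
  have h2 : |((-z : ℤ) : ℝ) - 1| = |(z : ℝ) + 1| := by
    rw [← abs_neg]; congr 1; push_cast; ring
  have h3 : |((-z : ℤ) : ℝ)| = |(z : ℝ)| := by push_cast; exact abs_neg _
  rw [h1, h2, h3]
  ring

theorem fracCorr_natAbs (H : ℝ) (z : ℤ) : fracCorr H z.natAbs = fracCorr H z := by
  rcases Int.natAbs_eq z with h | h
  · rw [← h]
  · conv_rhs => rw [h]
    rw [fracCorr_neg]

theorem fracCorr_zero {H : ℝ} (hH : 0 < H) : fracCorr H 0 = 1 := by
  have : (2 * H) ≠ 0 := by positivity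
  simp [fracCorr, Real.zero_rpow this]

/-- A second-order mean value formula. -/
theorem exists_fracCorr_eq {H : ℝ} (hH : 0 < H) {k : ℕ} (hk : 1 ≤ k) :
    ∃ z ∈ Set.Ioo ((k : ℝ) - 1) (k + 1),
      fracCorr H k = H * (2 * H - 1) * z ^ (2 * H - 2) := by
  have hk' : (1 : ℝ) ≤ k := by exact_mod_cast hk
  set p := 2 * H with hp
  have hp0 : 0 < p := by positivity
  -- Cauchy's mean value theorem against `t ^ 2` on `[0, 1]`, followed by the ordinary one for `x ^
  -- (p - 1)` on `[k - c, k + c]`. Only continuity is needed at `t = 1`, where `k - t` vanishes if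
  -- `k = 1`.
  obtain ⟨c, hc, hce⟩ := exists_ratio_hasDerivAt_eq_ratio_slope
    (fun t : ℝ => ((k : ℝ) + t) ^ p + ((k : ℝ) - t) ^ p)
    (fun t => p * ((k : ℝ) + t) ^ (p - 1) - p * ((k : ℝ) - t) ^ (p - 1)) zero_lt_one
    (by
      refine ContinuousOn.add ?_ ?_ <;>
        exact ContinuousOn.rpow_const (by fun_prop) fun _ _ => Or.inr hp0.le)
    (fun t ht => by
      have h1 := ((hasDerivAt_id t).const_add (k : ℝ)).rpow_const (p := p)
        (Or.inl (by simp only [id]; linarith [ht.1]))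
      have h2 := ((hasDerivAt_id t).const_sub (k : ℝ)).rpow_const (p := p)
        (Or.inl (by simp only [id]; linarith [ht.2]))
      refine (h1.add h2).congr_deriv ?_
      simp only [id]
      ring)
    (fun t : ℝ => t ^ 2) (fun t => 2 * t) (by fun_prop)
    (fun t _ => by simpa using hasDerivAt_pow 2 t)
  have hc0 := hc.1
  have hc1 := hc.2
  obtain ⟨z, hz, hze⟩ := exists_hasDerivAt_eq_slope (fun x : ℝ => x ^ (p - 1))
    (fun x => (p - 1) * x ^ (p - 1 - 1)) (a := (k : ℝ) - c) (b := k + c) (by linarith)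
    (fun x hx => (Real.continuousAt_rpow_const _ _
      (Or.inl (by linarith [hx.1]))).continuousWithinAt)
    (fun x hx => Real.hasDerivAt_rpow_const (Or.inl (by linarith [hx.1])))
  refine ⟨z, ⟨by linarith [hz.1], by linarith [hz.2]⟩, ?_⟩
  rw [eq_div_iff (by linarith)] at hze
  have hfr : 2 * fracCorr H k = ((k : ℝ) + 1) ^ p + ((k : ℝ) - 1) ^ p - 2 * (k : ℝ) ^ p := by
    unfold fracCorr
    rw [Int.cast_natCast, abs_of_nonneg (by linarith : (0 : ℝ) ≤ k + 1),
      abs_of_nonneg (by linarith : (0 : ℝ) ≤ k - 1), abs_of_nonneg (by linarith : (0 : ℝ) ≤ k)]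
    ring
  simp only [add_zero, sub_zero, one_pow, one_mul, ne_eq, OfNat.ofNat_ne_zero, not_false_eq_true,
    zero_pow] at hce
  have e : p - 1 - 1 = p - 2 := by ring
  rw [e] at hze
  have key : (4 * c) * fracCorr H k = (4 * c) * (H * (p - 1) * z ^ (p - 2)) := by
    have h1 : 4 * c * fracCorr H k = p * (((k : ℝ) + c) ^ (p - 1) - ((k : ℝ) - c) ^ (p - 1)) := by
      linear_combination (2 * c) * hfr - hce
    rw [h1, ← hze, hp]
    ring
  exact mul_left_cancel₀ (by positivity) key

theorem abs_fracCorr_natCast_le {H : ℝ} (hH0 : 0 < H) (hH : H ≤ 3 / 4) (k : ℕ) :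
    |fracCorr H k| ≤ 8 * ((k : ℝ) + 1) ^ (2 * H - 2) := by
  rcases Nat.lt_or_ge k 2 with hk | hk
  · interval_cases k
    · rw [Nat.cast_zero, fracCorr_zero hH0]
      norm_num
    · have h0 : (2 * H) ≠ 0 := by positivity
      have e : fracCorr H (1 : ℕ) = (2 ^ (2 * H) - 2) / 2 := by
        norm_num [fracCorr, Real.zero_rpow h0]
      have l1 : (1 : ℝ) ≤ 2 ^ (2 * H) := Real.one_le_rpow (by norm_num) (by positivity)
      have l2 : (2 : ℝ) ^ (2 * H) ≤ 2 ^ (2 : ℝ) :=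
        Real.rpow_le_rpow_of_exponent_le (by norm_num) (by linarith)
      have l3 : (2 : ℝ) ^ (-2 : ℝ) ≤ 2 ^ (2 * H - 2) :=
        Real.rpow_le_rpow_of_exponent_le (by norm_num) (by linarith)
      norm_num [Real.rpow_neg] at l2 l3
      rw [e, abs_le]
      norm_num
      constructor <;> linarith
  · obtain ⟨z, hz, hze⟩ := exists_fracCorr_eq hH0 (by omega : 1 ≤ k)
    have hk' : (2 : ℝ) ≤ k := by exact_mod_cast hk
    -- For `k ≥ 2`, `k - 1 ≥ (k + 1) / 3`. Since `2 - 2H ≤ 2`, the comparison costs at most `3² =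
    -- 9`, and `3 / 8 * 9 ≤ 8`.
    have hz3 : ((k : ℝ) + 1) / 3 ≤ z := by linarith [hz.1]
    have hz0 : 0 < z := by linarith
    have h1 : z ^ (2 * H - 2) ≤ 9 * ((k : ℝ) + 1) ^ (2 * H - 2) := by
      refine (Real.rpow_le_rpow_of_nonpos (by positivity) hz3 (by linarith)).trans ?_
      rw [Real.div_rpow (by positivity) (by norm_num), div_eq_inv_mul,
        ← Real.rpow_neg (by norm_num)]
      gcongr
      calc (3 : ℝ) ^ (-(2 * H - 2)) ≤ 3 ^ (2 : ℝ) :=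
            Real.rpow_le_rpow_of_exponent_le (by norm_num) (by linarith)
        _ = 9 := by norm_num
    have h2 : |H * (2 * H - 1)| ≤ 3 / 8 := by
      rw [abs_le]; constructor <;> nlinarith [sq_nonneg (H - 1 / 4)]
    rw [hze, abs_mul, abs_of_pos (Real.rpow_pos_of_pos hz0 _)]
    have h3 : (0 : ℝ) < ((k : ℝ) + 1) ^ (2 * H - 2) := by positivity
    calc _ ≤ 3 / 8 * (9 * ((k : ℝ) + 1) ^ (2 * H - 2)) := by gcongr
      _ ≤ _ := by linarith

theorem fracCorr_sq_le {H : ℝ} (hH0 : 0 < H) (hH : H ≤ 3 / 4) (k : ℕ) :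
    fracCorr H ((k : ℤ) + 1) ^ 2 ≤ 64 * ((k : ℝ) + 1) ^ (4 * H - 3 - 1) := by
  have h := abs_fracCorr_natCast_le hH0 hH (k + 1)
  rw [← sq_abs]
  push_cast at h
  have h2 : ((k : ℝ) + 1 + 1) ^ (2 * H - 2) ≤ ((k : ℝ) + 1) ^ (2 * H - 2) :=
    Real.rpow_le_rpow_of_nonpos (by positivity) (by linarith) (by linarith)
  calc _ ≤ (8 * ((k : ℝ) + 1) ^ (2 * H - 2)) ^ 2 := by gcongr; linarith
    _ = 64 * (((k : ℝ) + 1) ^ (2 * H - 2)) ^ 2 := by ring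
    _ = _ := by
      rw [← Real.rpow_mul_natCast (by positivity)]; congr 2; push_cast; ring

/-- At `H = 3/4` the mean value formula squares to `(3/8)² / z` with `z < k + 2`: this is the
harmonic lower bound behind the logarithm. -/
theorem le_fracCorr_sq (k : ℕ) :
    9 / 64 * ((k : ℝ) + 1 + 1)⁻¹ ≤ fracCorr (3 / 4) ((k : ℤ) + 1) ^ 2 := by
  obtain ⟨z, hz, hze⟩ := exists_fracCorr_eq (H := 3 / 4) (by norm_num) (Nat.le_add_left 1 k)
  push_cast at hz hze
  have hz0 : 0 < z := by linarith [hz.1, k.cast_nonneg (α := ℝ)]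
  rw [hze, mul_pow, ← Real.rpow_mul_natCast hz0.le]
  norm_num [Real.rpow_neg_one]
  gcongr
  exact hz.2.le

/-- The cube root of the bound `8 (j + 1) ^ (2H - 2)` serves as `w`, and `w ^ 4` carries the factor
`16`. The exponent `(8H - 8) / 3` is written as `q - 1`, so that the sign of `q = (8H - 5) / 3`
decides the growth. -/
theorem trace_toeplitz_fracCorr_pow_four_le {H : ℝ} (hH0 : 0 < H) (hH : H ≤ 3 / 4) (d : ℕ) :
    (toeplitz (fracCorr H) d ^ 4).trace / (d : ℝ) ^ 2 ≤
      32 ^ 3 * (∑ j ∈ Finset.range d, ((j : ℝ) + 1) ^ ((8 * H - 5) / 3 - 1)) ^ 3 / d := by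
  have h := trace_toeplitz_pow_four_le (s := fracCorr H)
    (w := fun j => 2 * ((j : ℝ) + 1) ^ ((2 * H - 2) / 3)) (fun z => by
      rw [← fracCorr_natAbs]
      refine (abs_fracCorr_natCast_le hH0 hH _).trans (le_of_eq ?_)
      rw [mul_pow, ← Real.rpow_mul_natCast (by positivity)]
      norm_num) d
  have e : ∀ j : ℕ, (2 * ((j : ℝ) + 1) ^ ((2 * H - 2) / 3)) ^ 4
      = 16 * ((j : ℝ) + 1) ^ ((8 * H - 5) / 3 - 1) := fun j => by
    rw [mul_pow, ← Real.rpow_mul_natCast (by positivity)]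
    norm_num
    congr 1
    ring
  simp only [e, ← Finset.mul_sum] at h
  rcases Nat.eq_zero_or_pos d with rfl | hd
  · simp
  have hd' : (0 : ℝ) < d := by exact_mod_cast hd
  rw [div_le_div_iff₀ (by positivity) hd']
  calc _ ≤ _ := mul_le_mul_of_nonneg_right h hd'.le
    _ = _ := by ring

end FracCorr

/-! ### The variance parameter -/

section Variance

variable {s : ℤ → ℝ}

theorem one_le_trace_toeplitz_sq_div (heven : ∀ z, s (-z) = s z) (h0 : s 0 = 1) {d : ℕ}
    (hd : 1 ≤ d) : 1 ≤ (toeplitz s d ^ 2).trace / d := by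
  have hd' : (0 : ℝ) < d := by exact_mod_cast hd
  rw [le_div_iff₀ hd', one_mul, trace_toeplitz_sq heven, h0]
  calc (d : ℝ) = ∑ m ∈ Finset.range d, (1 : ℝ) := by simp
    _ ≤ _ := by
      refine Finset.sum_le_sum fun m _ => ?_
      have : 0 ≤ ∑ j ∈ Finset.range m, s ((j : ℤ) + 1) ^ 2 := by positivity
      linarith

theorem summable_sq_iff (heven : ∀ z, s (-z) = s z) :
    Summable (fun k : ℤ => s k ^ 2) ↔ Summable fun j : ℕ => s ((j : ℤ) + 1) ^ 2 := by
  constructor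
  · intro h
    refine h.comp_injective (i := fun j : ℕ => (j : ℤ) + 1) fun a b hab => ?_
    simpa using hab
  · intro h
    refine Summable.of_add_one_of_neg_add_one (by exact_mod_cast h) ?_
    simpa only [heven] using h

theorem ellTwoSq_eq (heven : ∀ z, s (-z) = s z) (h0 : s 0 = 1)
    (hs : Summable fun j : ℕ => s ((j : ℤ) + 1) ^ 2) :
    (ellTwoSq s : ℝ) = 1 + 2 * ∑' j : ℕ, s ((j : ℤ) + 1) ^ 2 := by
  have h1 : HasSum (fun j : ℕ => s (j : ℤ) ^ 2) (1 + ∑' j : ℕ, s ((j : ℤ) + 1) ^ 2) := by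
    have := (hasSum_nat_add_iff (f := fun j : ℕ => s (j : ℤ) ^ 2) 1).1
      (by simpa only [Nat.cast_add, Nat.cast_one] using hs.hasSum)
    simpa [h0, add_comm] using this
  have h2 : HasSum (fun j : ℕ => s (-((j : ℤ) + 1)) ^ 2) (∑' j : ℕ, s ((j : ℤ) + 1) ^ 2) := by
    simpa only [heven] using hs.hasSum
  have h3 := (HasSum.of_nat_of_neg_add_one (f := fun k : ℤ => s k ^ 2) h1 h2).tsum_eq
  rw [ellTwoSq, Real.coe_toNNReal _ (tsum_nonneg fun _ => sq_nonneg _), h3]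
  ring

/-- A Cesàro mean of partial sums differs from the limit by the average of the tails, and the `m`-th
tail is of order `(m + 1) ^ q`. -/
theorem abs_trace_toeplitz_sq_div_sub_le (heven : ∀ z, s (-z) = s z) (h0 : s 0 = 1) {C q : ℝ}
    (hq : q < 0) (hC : ∀ j : ℕ, s ((j : ℤ) + 1) ^ 2 ≤ C * ((j : ℝ) + 1) ^ (q - 1)) {d : ℕ}
    (hd : 1 ≤ d) :
    Summable (fun j : ℕ => s ((j : ℤ) + 1) ^ 2) ∧
    |(toeplitz s d ^ 2).trace / d - ellTwoSq s| ≤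
      2 * (C * (1 + 1 / -q)) * (∑ m ∈ Finset.range d, ((m : ℝ) + 1) ^ q) / d := by
  have hq' : 0 < -q := by linarith
  have hd' : (0 : ℝ) < d := by exact_mod_cast hd
  have hC0 : 0 ≤ C := by
    have := (sq_nonneg _).trans (hC 0)
    simpa using this
  set f : ℕ → ℝ := fun j => s ((j : ℤ) + 1) ^ 2 with hf
  have hf0 : ∀ j, 0 ≤ f j := fun j => sq_nonneg _
  have hpart : ∀ m N : ℕ, ∑ i ∈ Finset.range N, f (i + m) ≤
      C * (1 + 1 / -q) * ((m : ℝ) + 1) ^ q := fun m N => by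
    calc _ ≤ ∑ i ∈ Finset.range N, C * ((i : ℝ) + m + 1) ^ (q - 1) :=
          Finset.sum_le_sum fun i _ => by simpa [hf] using hC (i + m)
      _ ≤ C * ((1 + 1 / -q) * ((m : ℝ) + 1) ^ q) := by
          rw [← Finset.mul_sum]
          exact mul_le_mul_of_nonneg_left (sum_rpow_le_of_neg hq m N) hC0
      _ = _ := by ring
  have hsum : Summable f := summable_of_sum_range_le hf0 (hpart 0)
  refine ⟨hsum, ?_⟩
  have htail : ∀ m, ∑' i, f (i + m) ≤ C * (1 + 1 / -q) * ((m : ℝ) + 1) ^ q := fun m =>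
    Real.tsum_le_of_sum_range_le (fun i => hf0 _) (hpart m)
  have e : (toeplitz s d ^ 2).trace / d - ellTwoSq s
      = -((∑ m ∈ Finset.range d, 2 * ∑' i, f (i + m)) / d) := by
    rw [ellTwoSq_eq heven h0 hsum, trace_toeplitz_sq heven, h0]
    have e1 : ∀ m, 2 * ∑' i, f (i + m) = 1 + 2 * ∑' j, f j
        - (1 ^ 2 + 2 * ∑ j ∈ Finset.range m, f j) := fun m => by
      rw [← hsum.sum_add_tsum_nat_add m]; ring
    simp only [e1, Finset.sum_sub_distrib, Finset.sum_const, Finset.card_range, nsmul_eq_mul]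
    field_simp
    ring
  have hnn : 0 ≤ ∑ m ∈ Finset.range d, 2 * ∑' i, f (i + m) :=
    Finset.sum_nonneg fun m _ => mul_nonneg zero_le_two (tsum_nonneg fun i => hf0 _)
  rw [e, abs_neg, abs_of_nonneg (by positivity)]
  gcongr
  rw [Finset.mul_sum]
  refine Finset.sum_le_sum fun m _ => ?_
  linarith [htail m]

/-- A weak Stirling bound, by induction from `d log (1 + 1 / d) ≤ 1`. -/
theorem mul_log_sub_le_sum_log (d : ℕ) :
    d * Real.log d - d ≤ ∑ m ∈ Finset.range d, Real.log ((m : ℝ) + 1) := by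
  induction d with
  | zero => simp
  | succ d ih =>
    rw [Finset.sum_range_succ]
    push_cast
    have : d * (Real.log (d + 1) - Real.log d) ≤ 1 := by
      rcases Nat.eq_zero_or_pos d with rfl | hd
      · simp
      have hd' : (0 : ℝ) < d := by exact_mod_cast hd
      rw [← Real.log_div (by positivity) (by positivity)]
      have := Real.log_le_sub_one_of_pos (x := ((d : ℝ) + 1) / d) (by positivity)
      calc _ ≤ d * (((d : ℝ) + 1) / d - 1) := by gcongr
        _ = 1 := by field_simp; ring
    linarith

theorem log_le_trace_toeplitz_sq_div {d : ℕ} (hd : 1 ≤ d) :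
    Real.log d ≤ 9 * ((toeplitz (fracCorr (3 / 4)) d ^ 2).trace / d) := by
  have hd' : (0 : ℝ) < d := by exact_mod_cast hd
  have h0 := fracCorr_zero (H := 3 / 4) (by norm_num)
  have h1 := one_le_trace_toeplitz_sq_div (fracCorr_neg (3 / 4)) h0 hd
  have hR : ∀ m : ℕ, 9 / 64 * Real.log ((m : ℝ) + 1) ≤ fracCorr (3 / 4) 0 ^ 2 +
      2 * ∑ j ∈ Finset.range m, fracCorr (3 / 4) ((j : ℤ) + 1) ^ 2 := fun m => by
    have h2 : 9 / 64 * Real.log ((m : ℝ) + 1)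
        ≤ 2 * ∑ j ∈ Finset.range m, fracCorr (3 / 4) ((j : ℤ) + 1) ^ 2 := by
      rw [Finset.mul_sum]
      refine (mul_le_mul_of_nonneg_left (log_le_sum_inv m) (by norm_num)).trans ?_
      rw [Finset.mul_sum]
      refine Finset.sum_le_sum fun j _ => ?_
      have h3 := le_fracCorr_sq j
      have h4 : ((j : ℝ) + 1)⁻¹ / 2 ≤ ((j : ℝ) + 1 + 1)⁻¹ := by
        rw [← one_div, div_div, ← one_div]
        apply one_div_le_one_div_of_le (by positivity)
        linarith [j.cast_nonneg (α := ℝ)]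
      linarith
    linarith [sq_nonneg (fracCorr (3 / 4) 0)]
  -- Together with the lower bound `1` this gives the constant `64 / 9 + 1 ≤ 9`.
  have h5 : 9 / 64 * (Real.log d - 1) ≤ (toeplitz (fracCorr (3 / 4)) d ^ 2).trace / d := by
    rw [le_div_iff₀ hd', trace_toeplitz_sq (fracCorr_neg _)]
    refine le_trans ?_ (Finset.sum_le_sum fun m _ => hR m)
    rw [← Finset.mul_sum]
    have := mul_log_sub_le_sum_log d
    linarith
  linarith

theorem not_summable_fracCorr_sq : ¬ Summable fun k : ℤ => fracCorr (3 / 4) k ^ 2 := by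
  rw [summable_sq_iff (fracCorr_neg _)]
  intro h
  have h1 : Summable fun k : ℕ => 9 / 64 * ((k : ℝ) + 1 + 1)⁻¹ :=
    Summable.of_nonneg_of_le (fun k => by positivity) le_fracCorr_sq h
  have h2 : Summable fun k : ℕ => (((k + 2 : ℕ) : ℝ))⁻¹ := by
    refine (h1.mul_left (64 / 9)).congr fun k => ?_
    push_cast
    rw [add_assoc, one_add_one_eq_two]
    ring
  exact Real.not_summable_natCast_inv ((summable_nat_add_iff 2).1 h2)

end Variance

/-! ### Closeness of the three ensembles -/

section Closeness

variable {Ω : Type*} [MeasurableSpace Ω] {P : Measure Ω} [IsProbabilityMeasure P]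
  {X : ℕ → ℕ → Ω → ℝ} {H : ℝ}

theorem phiClose_wishartLaw_of_le (hX : IsRowIndepGaussianArray (fracCorr H) X P) (hH0 : 0 < H)
    {φ : ℕ → ℕ → ℝ≥0∞} {ψ : ℕ → ℝ} {C : ℝ} {d₀ : ℕ} (hd₀ : 1 ≤ d₀)
    (hφ : ∀ n d, d₀ ≤ d → (φ n d).toReal = (n : ℝ) ^ 3 * ψ d)
    (hψ : ∀ d, d₀ ≤ d → (toeplitz (fracCorr H) d ^ 4).trace / (d : ℝ) ^ 2 /
      ((toeplitz (fracCorr H) d ^ 2).trace / d) ≤ C * ψ d) :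
    PhiClose φ (fun n d => wishartLaw X P n d) (fun n d => gaussianCounterpartLaw X P n d) := by
  refine phiClose_of_le (r := fun x => Real.pi * √(C * x)) ?_ (d₀ := d₀) fun n d hn hd => ?_
  · have : Continuous fun x : ℝ => Real.pi * √(C * x) := by fun_prop
    simpa using this.tendsto 0
  have h1 := one_le_trace_toeplitz_sq_div (fracCorr_neg H) (fracCorr_zero hH0) (hd₀.trans hd)
  have hd' : (0 : ℝ) < d := by exact_mod_cast hd₀.trans hd
  have hS : 0 < (toeplitz (fracCorr H) d ^ 2).trace := by
    rw [le_div_iff₀ hd'] at h1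
    linarith
  obtain ⟨h2, h3⟩ := fortetMourierDist_wishartLaw hX (fracCorr_zero hH0) n (hd₀.trans hd) hS
  refine ⟨h2, h3.trans ?_⟩
  rw [hφ n d hd, mul_div_assoc, mul_left_comm C]
  have := hψ d hd
  gcongr

theorem phiClose_gaussianCounterpartLaw_of_le (hX : IsRowIndepGaussianArray (fracCorr H) X P)
    (hH0 : 0 < H) (hs : Summable fun j : ℕ => fracCorr H ((j : ℤ) + 1) ^ 2)
    {φ : ℕ → ℕ → ℝ≥0∞} {ψ : ℕ → ℝ} {C : ℝ} {d₀ : ℕ} (hd₀ : 1 ≤ d₀)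
    (hφ : ∀ n d, d₀ ≤ d → (φ n d).toReal = n * ψ d)
    (hψ : ∀ d, d₀ ≤ d →
      |(toeplitz (fracCorr H) d ^ 2).trace / d - ellTwoSq (fracCorr H)| ≤ C * ψ d) :
    PhiClose φ (fun n d => gaussianCounterpartLaw X P n d)
      (fun n _ => goeLaw (ellTwoSq (fracCorr H)) n) := by
  refine phiClose_of_le (r := fun x => 2 * (C * x)) ?_ (d₀ := d₀) fun n d hn hd => ?_
  · have : Continuous fun x : ℝ => 2 * (C * x) := by fun_prop
    simpa using this.tendsto 0
  have h1 := one_le_trace_toeplitz_sq_div (fracCorr_neg H) (fracCorr_zero hH0) (hd₀.trans hd)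
  have hv : (1 : ℝ) ≤ ellTwoSq (fracCorr H) := by
    rw [ellTwoSq_eq (fracCorr_neg H) (fracCorr_zero hH0) hs]
    have : 0 ≤ ∑' j : ℕ, fracCorr H ((j : ℤ) + 1) ^ 2 := tsum_nonneg fun _ => sq_nonneg _
    linarith
  obtain ⟨h2, h3⟩ := fortetMourierDist_gaussianCounterpartLaw hX (fracCorr_zero hH0) n
    (hd₀.trans hd) (ellTwoSq (fracCorr H))
  refine ⟨h2, h3.trans ?_⟩
  set a := (toeplitz (fracCorr H) d ^ 2).trace / d
  set b : ℝ := (ellTwoSq (fracCorr H) : ℝ)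
  -- Both variances are at least `1`, so the square root is a contraction there.
  have h4 : |√a - √b| ≤ |a - b| := by
    have e : a - b = (√a - √b) * (√a + √b) := by
      rw [mul_comm, ← sq_sub_sq, Real.sq_sqrt (by linarith), Real.sq_sqrt (by linarith)]
    have h5 : 1 ≤ √a := Real.one_le_sqrt.2 h1
    have h6 : 0 ≤ √b := Real.sqrt_nonneg b
    rw [e, abs_mul, abs_of_nonneg (by linarith : 0 ≤ √a + √b)]
    exact le_mul_of_one_le_right (abs_nonneg _) (by linarith)
  calc _ ≤ 2 * n * (C * ψ d) := by
        gcongr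
        exact h4.trans (hψ d hd)
    _ = 2 * (C * (φ n d).toReal) := by rw [hφ n d hd]; ring

/-- The denominator is replaced by its lower bound `1`. At `H = 3/4` this would lose the logarithm,
so that case is treated separately. -/
theorem trace_pow_four_div_le (hH0 : 0 < H) (hH : H ≤ 3 / 4) {d : ℕ} (hd : 1 ≤ d) {B : ℝ}
    (hB : ∑ j ∈ Finset.range d, ((j : ℝ) + 1) ^ ((8 * H - 5) / 3 - 1) ≤ B) :
    (toeplitz (fracCorr H) d ^ 4).trace / (d : ℝ) ^ 2 /
      ((toeplitz (fracCorr H) d ^ 2).trace / d) ≤ 32 ^ 3 * B ^ 3 / d := by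
  have h1 := one_le_trace_toeplitz_sq_div (fracCorr_neg H) (fracCorr_zero hH0) hd
  have h0 : 0 ≤ ∑ j ∈ Finset.range d, ((j : ℝ) + 1) ^ ((8 * H - 5) / 3 - 1) := by positivity
  have hB0 := h0.trans hB
  refine div_le_of_le_mul₀ (by linarith) (by positivity) ?_
  calc _ ≤ _ := trace_toeplitz_fracCorr_pow_four_le hH0 hH d
    _ ≤ 32 ^ 3 * B ^ 3 / d := by gcongr
    _ ≤ _ := le_mul_of_one_le_right (by positivity) h1

theorem phiClose_wishartLaw_of_lt (hX : IsRowIndepGaussianArray (fracCorr H) X P) (hH0 : 0 < H)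
    (hH : H < 5 / 8) :
    PhiClose (fun n d => (n : ℝ≥0∞) ^ 3 / (d : ℝ≥0∞))
      (fun n d => wishartLaw X P n d) (fun n d => gaussianCounterpartLaw X P n d) := by
  have hr : (8 * H - 5) / 3 < 0 := by linarith
  refine phiClose_wishartLaw_of_le hX hH0 (ψ := fun d => (d : ℝ)⁻¹) le_rfl
    (C := 32 ^ 3 * (1 + 1 / -((8 * H - 5) / 3)) ^ 3)
    (fun n d _ => by simp [div_eq_mul_inv]) fun d hd => ?_
  refine (trace_pow_four_div_le hH0 (by linarith) hd (B := 1 + 1 / -((8 * H - 5) / 3)) ?_).trans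
    (le_of_eq (by rw [div_eq_mul_inv]))
  simpa using sum_rpow_le_of_neg hr 0 d

theorem phiClose_wishartLaw_five_eighths (hX : IsRowIndepGaussianArray (fracCorr (5 / 8)) X P) :
    PhiClose (fun n d => (n : ℝ≥0∞) ^ 3 * ENNReal.ofReal (Real.log d) ^ 3 / (d : ℝ≥0∞))
      (fun n d => wishartLaw X P n d) (fun n d => gaussianCounterpartLaw X P n d) := by
  -- From `d = 3` on, `1 + log d ≤ 2 log d`; the cube of this `2` is the `8` in `C`.
  have hlog : ∀ d : ℕ, 3 ≤ d → 1 ≤ Real.log d := fun d hd => by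
    have hd' : (3 : ℝ) ≤ d := by exact_mod_cast hd
    rw [Real.le_log_iff_exp_le (by linarith)]
    linarith [Real.exp_one_lt_d9]
  refine phiClose_wishartLaw_of_le hX (by norm_num) (ψ := fun d => Real.log d ^ 3 / d)
    (d₀ := 3) (C := 32 ^ 3 * 8) (by norm_num) (fun n d hd => ?_) fun d hd => ?_
  · have := hlog d hd
    rw [ENNReal.toReal_div, ENNReal.toReal_mul, ENNReal.toReal_pow, ENNReal.toReal_pow,
      ENNReal.toReal_ofReal (by linarith)]
    simp [mul_div_assoc]
  · refine (trace_pow_four_div_le (by norm_num) (by norm_num) (by omega)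
      (B := 2 * Real.log d) ?_).trans (le_of_eq (by ring))
    have h1 := sum_inv_le d
    have h2 := hlog d hd
    norm_num [Real.rpow_neg_one]
    linarith

theorem rpow_div_pow_three_div_eq {q : ℝ} (h0 : 0 < q) {d : ℕ} (hd : 1 ≤ d) :
    32 ^ 3 * ((d : ℝ) ^ q / q) ^ 3 / d = 32 ^ 3 / q ^ 3 * (d : ℝ) ^ (3 * q - 1) := by
  have hd' : (0 : ℝ) < d := by exact_mod_cast hd
  rw [Real.rpow_sub_one hd'.ne', mul_comm 3 q, Real.rpow_mul hd'.le]
  norm_num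
  field_simp

theorem phiClose_wishartLaw_of_gt (hX : IsRowIndepGaussianArray (fracCorr H) X P)
    (hH0 : 5 / 8 < H) (hH : H ≤ 3 / 4) :
    PhiClose (fun n d => (n : ℝ≥0∞) ^ 3 * (d : ℝ≥0∞) ^ (8 * H - 6))
      (fun n d => wishartLaw X P n d) (fun n d => gaussianCounterpartLaw X P n d) := by
  have hr : 0 < (8 * H - 5) / 3 := by linarith
  refine phiClose_wishartLaw_of_le hX (by linarith) (ψ := fun d => (d : ℝ) ^ (8 * H - 6)) le_rfl
    (C := 32 ^ 3 / ((8 * H - 5) / 3) ^ 3)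
    (fun n d _ => by simp [← ENNReal.toReal_rpow]) fun d hd => ?_
  refine (trace_pow_four_div_le (by linarith) hH hd
    (sum_rpow_le_of_pos hr (by linarith) d)).trans (le_of_eq ?_)
  rw [rpow_div_pow_three_div_eq hr hd]
  congr 2
  ring

theorem phiClose_wishartLaw_three_quarters
    (hX : IsRowIndepGaussianArray (fracCorr (3 / 4)) X P) :
    PhiClose (fun n d => (n : ℝ≥0∞) ^ 3 / ENNReal.ofReal (Real.log d))
      (fun n d => wishartLaw X P n d) (fun n d => gaussianCounterpartLaw X P n d) := by
  refine phiClose_wishartLaw_of_le hX (by norm_num) (ψ := fun d => (Real.log d)⁻¹)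
    (d₀ := 2) (C := 32 ^ 3 * 27 * 9) (by norm_num) (fun n d hd => ?_) fun d hd => ?_
  · have h2 : (2 : ℝ) ≤ d := by exact_mod_cast hd
    rw [ENNReal.toReal_div, ENNReal.toReal_pow,
      ENNReal.toReal_ofReal (Real.log_nonneg (by linarith))]
    simp [div_eq_mul_inv]
  · have h2 : (2 : ℝ) ≤ d := by exact_mod_cast hd
    have hlog : 0 < Real.log d := Real.log_pos (by linarith)
    have hS := log_le_trace_toeplitz_sq_div (d := d) (by omega)
    have hQ := trace_toeplitz_fracCorr_pow_four_le (H := 3 / 4) (by norm_num) le_rfl d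
    have h3 := sum_rpow_le_of_pos (q := (8 * (3 / 4) - 5) / 3) (by norm_num) (by norm_num) d
    -- Here `q = 1 / 3`, so `3 * q - 1 = 0`: the numerator is bounded, with `27 = q⁻³`, and all
    -- decay comes from the denominator.
    have h4 : (toeplitz (fracCorr (3 / 4)) d ^ 4).trace / (d : ℝ) ^ 2 ≤ 32 ^ 3 * 27 := by
      refine hQ.trans ?_
      calc _ ≤ 32 ^ 3 * ((d : ℝ) ^ ((8 * (3 / 4) - 5) / 3 : ℝ) / ((8 * (3 / 4) - 5) / 3)) ^ 3 / d := by
            gcongr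
        _ ≤ _ := by
            rw [rpow_div_pow_three_div_eq (by norm_num) (by omega)]
            norm_num
    rw [← div_eq_mul_inv, div_le_div_iff₀ (by linarith) hlog]
    calc _ ≤ 32 ^ 3 * 27 * Real.log d := by gcongr
      _ ≤ _ := by rw [mul_assoc (32 ^ 3 * 27 : ℝ)]; gcongr

theorem summable_fracCorr_sq_and_abs_sub_le (hH0 : 0 < H) (hH : H < 3 / 4) {d : ℕ}
    (hd : 1 ≤ d) :
    Summable (fun j : ℕ => fracCorr H ((j : ℤ) + 1) ^ 2) ∧
    |(toeplitz (fracCorr H) d ^ 2).trace / d - ellTwoSq (fracCorr H)| ≤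
      2 * (64 * (1 + 1 / -(4 * H - 3))) *
        (∑ m ∈ Finset.range d, ((m : ℝ) + 1) ^ (4 * H - 3)) / d :=
  abs_trace_toeplitz_sq_div_sub_le (fracCorr_neg H) (fracCorr_zero hH0) (by linarith)
    (fracCorr_sq_le hH0 hH.le) hd

/-- Below `1 / 2` the tail bounds `(m + 1) ^ (4H - 3)` are themselves summable, so their average is
of order `1 / d`. -/
theorem phiClose_gaussianCounterpartLaw_of_lt
    (hX : IsRowIndepGaussianArray (fracCorr H) X P) (hH0 : 0 < H) (hH : H < 1 / 2) :
    PhiClose (fun n d => (n : ℝ≥0∞) / (d : ℝ≥0∞))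
      (fun n d => gaussianCounterpartLaw X P n d)
      (fun n _ => goeLaw (ellTwoSq (fracCorr H)) n) := by
  have hH' : H < 3 / 4 := by linarith
  have hq : 4 * H - 2 < 0 := by linarith
  have hq' : 0 < -(4 * H - 3) := by linarith
  refine phiClose_gaussianCounterpartLaw_of_le hX hH0
    (summable_fracCorr_sq_and_abs_sub_le hH0 hH' le_rfl).1 le_rfl (ψ := fun d => (d : ℝ)⁻¹)
    (C := 2 * (64 * (1 + 1 / -(4 * H - 3))) * (1 + 1 / -(4 * H - 2)))
    (fun n d _ => by simp [div_eq_mul_inv]) fun d hd => ?_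
  refine (summable_fracCorr_sq_and_abs_sub_le hH0 hH' hd).2.trans ?_
  rw [← div_eq_mul_inv]
  gcongr
  have := sum_rpow_le_of_neg hq 0 d
  have e : 4 * H - 2 - 1 = 4 * H - 3 := by ring
  simpa [e] using this

theorem abs_trace_div_sub_ellTwoSq_le (hH0 : 1 / 2 < H) (hH : H < 3 / 4) {d : ℕ} (hd : 1 ≤ d) :
    |(toeplitz (fracCorr H) d ^ 2).trace / d - ellTwoSq (fracCorr H)| ≤
      2 * (64 * (1 + 1 / -(4 * H - 3))) / (4 * H - 2) * (d : ℝ) ^ (4 * H - 3) := by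
  have hd' : (0 : ℝ) < d := by exact_mod_cast hd
  have hq' : 0 < -(4 * H - 3) := by linarith
  refine (summable_fracCorr_sq_and_abs_sub_le (by linarith) hH hd).2.trans ?_
  have h := sum_rpow_le_of_pos (q := 4 * H - 2) (by linarith) (by linarith) d
  have e : 4 * H - 2 - 1 = 4 * H - 3 := by ring
  rw [e] at h
  calc _ ≤ 2 * (64 * (1 + 1 / -(4 * H - 3))) * ((d : ℝ) ^ (4 * H - 2) / (4 * H - 2)) / d := by
        gcongr
    _ = _ := by
        rw [← e, Real.rpow_sub_one hd'.ne']
        ring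

theorem phiClose_gaussianCounterpartLaw_of_gt
    (hX : IsRowIndepGaussianArray (fracCorr H) X P) (hH0 : 1 / 2 < H) (hH : H < 3 / 4)
    {φ : ℕ → ℕ → ℝ≥0∞} (hφ : ∀ n d, 1 ≤ d → (φ n d).toReal = n * (d : ℝ) ^ (4 * H - 3)) :
    PhiClose φ (fun n d => gaussianCounterpartLaw X P n d)
      (fun n _ => goeLaw (ellTwoSq (fracCorr H)) n) :=
  phiClose_gaussianCounterpartLaw_of_le hX (by linarith)
    (summable_fracCorr_sq_and_abs_sub_le (by linarith) hH le_rfl).1 le_rfl hφ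
    fun _ hd => abs_trace_div_sub_ellTwoSq_le hH0 hH hd

theorem gaussianCounterpartLaw_eq_goeLaw_one_half
    (hX : IsRowIndepGaussianArray (fracCorr H) X P) (hH : H = 1 / 2) (n : ℕ) {d : ℕ}
    (hd : 1 ≤ d) : gaussianCounterpartLaw X P n d = goeLaw (ellTwoSq (fracCorr H)) n := by
  have hd' : (d : ℝ) ≠ 0 := by positivity
  have hH0 : 0 < H := by linarith
  have h0 := fracCorr_zero hH0
  -- The factor `2 * H - 1` of the mean value formula vanishes.
  have h1 : ∀ j : ℕ, fracCorr H ((j : ℤ) + 1) = 0 := fun j => by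
    obtain ⟨z, _, hz⟩ := exists_fracCorr_eq hH0 (Nat.le_add_left 1 j)
    push_cast at hz
    rw [hz, hH]
    norm_num
  refine gaussianCounterpartLaw_eq_goeLaw hX h0 n hd ?_
  rw [trace_toeplitz_sq (fracCorr_neg _), ellTwoSq_eq (fracCorr_neg _) h0
    (by simp [h1])]
  simp [h1, h0, hd']

end Closeness

/-! ### Assembly of the six regimes. -/

theorem mainTheorem3 {Ω : Type*} [MeasurableSpace Ω] (P : Measure Ω) [IsProbabilityMeasure P]
    (H : ℝ) (hH0 : 0 < H) (hH : H ≤ 3 / 4) (X : ℕ → ℕ → Ω → ℝ)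
    (hX : IsRowIndepGaussianArray (fracCorr H) X P) :
    (H < 1 / 2 →
      PhiClose (fun n d => (n : ℝ≥0∞) ^ 3 / (d : ℝ≥0∞))
        (fun n d => wishartLaw X P n d) (fun n d => gaussianCounterpartLaw X P n d) ∧
      Summable (fun k : ℤ => fracCorr H k ^ 2) ∧
      PhiClose (fun n d => (n : ℝ≥0∞) / (d : ℝ≥0∞))
        (fun n d => gaussianCounterpartLaw X P n d)
        (fun n _ => goeLaw (ellTwoSq (fracCorr H)) n)) ∧
    (H = 1 / 2 →
      PhiClose (fun n d => (n : ℝ≥0∞) ^ 3 / (d : ℝ≥0∞))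
        (fun n d => wishartLaw X P n d) (fun n d => gaussianCounterpartLaw X P n d) ∧
      Summable (fun k : ℤ => fracCorr H k ^ 2) ∧
      ∀ n d : ℕ, 1 ≤ n → 1 ≤ d →
        gaussianCounterpartLaw X P n d = goeLaw (ellTwoSq (fracCorr H)) n) ∧
    (1 / 2 < H → H < 5 / 8 →
      PhiClose (fun n d => (n : ℝ≥0∞) ^ 3 / (d : ℝ≥0∞))
        (fun n d => wishartLaw X P n d) (fun n d => gaussianCounterpartLaw X P n d) ∧
      Summable (fun k : ℤ => fracCorr H k ^ 2) ∧
      PhiClose (fun n d => (n : ℝ≥0∞) * (d : ℝ≥0∞) ^ (4 * H - 3))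
        (fun n d => gaussianCounterpartLaw X P n d)
        (fun n _ => goeLaw (ellTwoSq (fracCorr H)) n)) ∧
    (H = 5 / 8 →
      PhiClose (fun n d => (n : ℝ≥0∞) ^ 3 * ENNReal.ofReal (Real.log d) ^ 3 / (d : ℝ≥0∞))
        (fun n d => wishartLaw X P n d) (fun n d => gaussianCounterpartLaw X P n d) ∧
      Summable (fun k : ℤ => fracCorr H k ^ 2) ∧
      PhiClose (fun n d => (n : ℝ≥0∞) / ENNReal.ofReal √(d : ℝ))
        (fun n d => gaussianCounterpartLaw X P n d)
        (fun n _ => goeLaw (ellTwoSq (fracCorr H)) n)) ∧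
    (5 / 8 < H → H < 3 / 4 →
      PhiClose (fun n d => (n : ℝ≥0∞) ^ 3 * (d : ℝ≥0∞) ^ (8 * H - 6))
        (fun n d => wishartLaw X P n d) (fun n d => gaussianCounterpartLaw X P n d) ∧
      Summable (fun k : ℤ => fracCorr H k ^ 2) ∧
      PhiClose (fun n d => (n : ℝ≥0∞) * (d : ℝ≥0∞) ^ (4 * H - 3))
        (fun n d => gaussianCounterpartLaw X P n d)
        (fun n _ => goeLaw (ellTwoSq (fracCorr H)) n)) ∧
    (H = 3 / 4 →
      PhiClose (fun n d => (n : ℝ≥0∞) ^ 3 / ENNReal.ofReal (Real.log d))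
        (fun n d => wishartLaw X P n d) (fun n d => gaussianCounterpartLaw X P n d) ∧
      ¬ Summable (fun k : ℤ => fracCorr H k ^ 2)) := by

  have hsum : H < 3 / 4 → Summable fun k : ℤ => fracCorr H k ^ 2 := fun h =>
    (summable_sq_iff (fracCorr_neg H)).2 (summable_fracCorr_sq_and_abs_sub_le hH0 h le_rfl).1
  have hrpow : ∀ n d : ℕ, 1 ≤ d → ((n : ℝ≥0∞) * (d : ℝ≥0∞) ^ (4 * H - 3)).toReal
      = n * (d : ℝ) ^ (4 * H - 3) := fun n d _ => by simp [← ENNReal.toReal_rpow]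
  refine ⟨fun h => ⟨phiClose_wishartLaw_of_lt hX hH0 (by linarith), hsum (by linarith),
      phiClose_gaussianCounterpartLaw_of_lt hX hH0 h⟩,
    fun h => ⟨phiClose_wishartLaw_of_lt hX hH0 (by linarith), hsum (by linarith),
      fun n d _ hd => ?_⟩,
    fun h h' => ⟨phiClose_wishartLaw_of_lt hX hH0 h', hsum (by linarith),
      phiClose_gaussianCounterpartLaw_of_gt hX h (by linarith) hrpow⟩,
    fun h => ⟨?_, hsum (by linarith),
      phiClose_gaussianCounterpartLaw_of_gt hX (by linarith) (by linarith) fun n d hd => ?_⟩,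
    fun h h' => ⟨phiClose_wishartLaw_of_gt hX h h'.le, hsum h',
      phiClose_gaussianCounterpartLaw_of_gt hX (by linarith) h' hrpow⟩,
    fun h => ?_⟩
  · exact gaussianCounterpartLaw_eq_goeLaw_one_half hX h n hd
  · subst h
    exact phiClose_wishartLaw_five_eighths hX
  -- At `H = 5/8` the general rate `d ^ (4H - 3)` is `1 / √d`.
  · have e : 4 * H - 3 = -(1 / 2) := by linarith
    rw [ENNReal.toReal_div, ENNReal.toReal_ofReal (Real.sqrt_nonneg _), e,
      Real.rpow_neg d.cast_nonneg, ← Real.sqrt_eq_rpow, div_eq_mul_inv]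
    simp
  · subst h
    exact ⟨phiClose_wishartLaw_three_quarters hX, not_summable_fracCorr_sq⟩
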